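/- Let $U\subset\mathbb{R}^n$ be bounded, open and connected, let $X=\overline U$, and let $\Omega=C([0,1];X)$ be the space of continuous paths in $X$ with the uniform metric. Let $c:\Omega\to(-\infty,+\infty]$ be lower semicontinuous (for instance, $c:\Omega\to\mathbb{R}$ lower semicontinuous), and put $$c_{\mathbf e}(x,y):=\inf\{c(\gamma):\gamma\in\Omega,\ \gamma(0)=x,\ \gamma(1)=y\}\in[-\infty,+\infty],\qquad \inf\emptyset=+\infty .$$ Let $\mu_0,\mu_1\in\mathcal P(X)$ be Borel probability measures and let $\Pi_{\rm path}(\mu_0,\mu_1)$ be the set of Borel probability measures $\pi$ on $\Omega$ whose images under $\gamma\mapsto\gamma(0)$ and $\gamma\mapsto\gamma(1)$ are $\mu_0$ and $\mu_1$. Here $\int_\Omega c\,d\pi:=\int_\Omega c^+\,d\pi-\int_\Omega c^-\,d\pi\in[-\infty,+\infty]$, and the value $+\infty$ is assigned if both terms are infinite (so that such $\pi$ do not influence an infimum). Assume that there are $f\in L^1(\mu_0)$ and $g\in L^1(\mu_1)$ with $c_{\mathbf e}(x,y)\le f(x)+g(y)$ for $\mu_0$-a.e. $x$ and $\mu_1$-a.e.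 $y$. (An inequality is said to hold for $\mu_0$-a.e. $x$ and $\mu_1$-a.e. $y$ if there are a $\mu_0$-null set $N_0$ and a $\mu_1$-null set $N_1$ such that it holds for all $x\in X\setminus N_0$ and all $y\in X\setminus N_1$.) (a) We have, as an equality in $[-\infty,+\infty]$, $$\inf_{\pi\in\Pi_{\rm path}(\mu_0,\mu_1)}\int_\Omega c(\gamma)\,d\pi(\gamma)=\sup\left\{\int_X\varphi\,d\mu_0+\int_X\psi\,d\mu_1\right\},$$ where the supremum is over all $\varphi\in L^1(\mu_0)$, $\psi\in L^1(\mu_1)$ with $\varphi(x)+\psi(y)\le c_{\mathbf e}(x,y)$ for $\mu_0$-a.e. $x$ and $\mu_1$-a.e. $y$ (and $\sup\emptyset=-\infty$). (b) If moreover $c$ is bounded from below, then the same equality holds with the supremum taken only over pairs of real-valued integrable functions $\varphi,\psi:X\to\mathbb R$ that satisfy $\varphi(x)+\psi(y)\le c_{\mathbf e}(x,y)$ for all $x,y\in X$. -/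

import Mathlib

open MeasureTheory Filter
open scoped ENNReal unitInterval

noncomputable section

/-- The path space of all continuous paths `γ : [0,1] → X`, with the topology of uniform
convergence (the compact-open topology, which is the one of the metric `max_t d(γ₁ t, γ₂ t)`). -/
abbrev PathSpace {n : ℕ} (X : Set (EuclideanSpace ℝ (Fin n))) : Type := C(I, X)

/-- Path space carries its Borel σ-algebra. -/
instance {n : ℕ} (X : Set (EuclideanSpace ℝ (Fin n))) : MeasurableSpace (PathSpace X) :=
  borel (PathSpace X)

instance {n : ℕ} (X : Set (EuclideanSpace ℝ (Fin n))) : BorelSpace (PathSpace X) := ⟨rfl⟩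

/-- The integral `∫ h dμ = ∫ h⁺ dμ - ∫ h⁻ dμ` of an extended real function, as an extended real
number. It is `+∞` as soon as `∫ h⁺ dμ = +∞`; so where both parts are infinite and the integral
has no meaning, its value `+∞` has no influence on an infimum. -/
def extIntegral {α : Type*} [MeasurableSpace α] (μ : Measure α) (h : α → EReal) : EReal :=
  if ∫⁻ a, (h a).toENNReal ∂μ = ∞ then ⊤
  else ((∫⁻ a, (h a).toENNReal ∂μ : ℝ≥0∞) : EReal) - ((∫⁻ a, (-h a).toENNReal ∂μ : ℝ≥0∞) : EReal)

/-- The set `Π_path(μ₀, μ₁)` of admissible plans: the Borel probability measures on path space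
whose images under the evaluations `γ ↦ γ 0` and `γ ↦ γ 1` are `μ₀` and `μ₁`. -/
def pathPlans {n : ℕ} {X : Set (EuclideanSpace ℝ (Fin n))} (μ₀ μ₁ : ProbabilityMeasure X) :
    Set (ProbabilityMeasure (PathSpace X)) :=
  {π | (π : Measure (PathSpace X)).map (fun γ => γ 0) = μ₀ ∧
    (π : Measure (PathSpace X)).map (fun γ => γ 1) = μ₁}

/-- The value `inf_π ∫ c dπ` of the optimal path problem. -/
def pathValue {n : ℕ} {X : Set (EuclideanSpace ℝ (Fin n))} (c : PathSpace X → EReal)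
    (μ₀ μ₁ : ProbabilityMeasure X) : EReal :=
  ⨅ π ∈ pathPlans μ₀ μ₁, extIntegral (π : Measure (PathSpace X)) c

/-- The endpoint cost `c_e(x, y)`, the infimum of `c` over the paths in `X` from `x` to `y`
(it is `+∞` if there is no such path). -/
def endpointCost {n : ℕ} {X : Set (EuclideanSpace ℝ (Fin n))} (c : PathSpace X → EReal)
    (x y : X) : EReal :=
  ⨅ (γ : PathSpace X) (_ : γ 0 = x ∧ γ 1 = y), c γ

/-- Dual pairs for `L¹` classes: `φ ∈ L¹(μ₀)`, `ψ ∈ L¹(μ₁)` and `φ(x) + ψ(y) ≤ c_e(x, y)` for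
`μ₀`-almost every `x` and `μ₁`-almost every `y`, that is, for all `x ∉ N₀` and `y ∉ N₁` with
a `μ₀`-null set `N₀` and a `μ₁`-null set `N₁`. -/
def dualPairsAE {n : ℕ} {X : Set (EuclideanSpace ℝ (Fin n))} (c : PathSpace X → EReal)
    (μ₀ μ₁ : ProbabilityMeasure X) : Set ((X → ℝ) × (X → ℝ)) :=
  {p | Integrable p.1 (μ₀ : Measure X) ∧ Integrable p.2 (μ₁ : Measure X) ∧
    ∀ᶠ z in ae (μ₀ : Measure X) ×ˢ ae (μ₁ : Measure X),
      ((p.1 z.1 + p.2 z.2 : ℝ) : EReal) ≤ endpointCost c z.1 z.2}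

/-- Dual pairs for functions: `φ ∈ L¹(μ₀)`, `ψ ∈ L¹(μ₁)` and `φ(x) + ψ(y) ≤ c_e(x, y)` for all
`x` and `y`. -/
def dualPairs {n : ℕ} {X : Set (EuclideanSpace ℝ (Fin n))} (c : PathSpace X → EReal)
    (μ₀ μ₁ : ProbabilityMeasure X) : Set ((X → ℝ) × (X → ℝ)) :=
  {p | Integrable p.1 (μ₀ : Measure X) ∧ Integrable p.2 (μ₁ : Measure X) ∧
    ∀ x y : X, ((p.1 x + p.2 y : ℝ) : EReal) ≤ endpointCost c x y}

/-- The supremum of `∫ φ dμ₀ + ∫ ψ dμ₁` over a set of pairs `(φ, ψ)`. -/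
def dualValue {n : ℕ} {X : Set (EuclideanSpace ℝ (Fin n))} (P : Set ((X → ℝ) × (X → ℝ)))
    (μ₀ μ₁ : ProbabilityMeasure X) : EReal :=
  ⨆ p ∈ P, ((∫ x, p.1 x ∂(μ₀ : Measure X) + ∫ y, p.2 y ∂(μ₁ : Measure X) : ℝ) : EReal)

end

/-! The inequality from dual to primal is integration of `φ(γ 0) + ψ(γ 1) ≤ c γ` against a plan. For
the converse, paths matter only through the two maps `e₀`, `e₁` on a standard Borel space `Ω`. On
the set where `c ≤ f ∘ e₀ + g ∘ e₁`, the gap `h = f ∘ e₀ + g ∘ e₁ - c` is real and nonnegative.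
Minimising `∫ c` there means maximising `∫ h`, and pairs `(φ, ψ)` in `[0, ∞]` with `h ≤ φ ∘ e₀ + ψ ∘
e₁` correspond to the dual pairs `(f - φ, g - ψ)`.

Maximisation is first done with marginals at most `μ` and `ν`. On a compact space this is
Hahn-Banach and Riesz (`exists_measure_map_le_of_compact`). The reduction to a compact set rests on
the dual value being continuous along increasing sets, like a capacity (`exists_dominating_iUnion`):
near-optimal pairs are selected by minimising a strictly convex functional of `exp (-φ)`, `exp
(-ψ)`, and then converge almost everywhere. A capacity argument (`exists_isCompact_forall_isOpen`)
gives a compact set whose neighbourhoods all keep the dual value above the given level. Merely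
measurable data become continuous in a finer Polish topology.

A partial plan is completed by a plan between the residual marginals (`exists_measure_map_eq`). This
does not lower `∫ h`, since `h ≥ 0`. No measurability of the endpoint cost is needed, as the
constraint is tested on paths.

For the pointwise form of the dual, pairs are truncated from above and made very negative on the
null sets. -/

open scoped Topology NNReal BoundedContinuousFunction

/-! ### Exponential coordinates and almost everywhere convergence -/

/-- The decreasing homeomorphism `t ↦ exp (-t)` from `[0, ∞]` onto `[0, 1]`. -/
noncomputable def expNeg (t : ℝ≥0∞) : ℝ := (EReal.exp (-(t : EReal))).toReal

lemma exp_neg_coe_le_one (t : ℝ≥0∞) : EReal.exp (-(t : EReal)) ≤ 1 := by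
  rw [← EReal.exp_zero]
  exact EReal.exp_monotone (EReal.neg_le_zero.2 (EReal.coe_ennreal_nonneg t))

lemma exp_neg_coe_ne_top (t : ℝ≥0∞) : EReal.exp (-(t : EReal)) ≠ ∞ :=
  ((exp_neg_coe_le_one t).trans_lt ENNReal.one_lt_top).ne

lemma expNeg_nonneg (t : ℝ≥0∞) : 0 ≤ expNeg t := ENNReal.toReal_nonneg

lemma expNeg_le_one (t : ℝ≥0∞) : expNeg t ≤ 1 :=
  ENNReal.toReal_le_of_le_ofReal zero_le_one (by simpa using exp_neg_coe_le_one t)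

lemma continuous_expNeg : Continuous expNeg := by
  refine ENNReal.continuousOn_toReal.comp_continuous ?_ exp_neg_coe_ne_top
  exact ENNReal.logOrderIso.symm.continuous.comp (continuous_neg.comp continuous_coe_ennreal_ereal)

lemma expNeg_injective : Function.Injective expNeg := by
  intro a b hab
  have h := (ENNReal.toReal_eq_toReal_iff' (exp_neg_coe_ne_top a) (exp_neg_coe_ne_top b)).1 hab
  have h' := EReal.exp_strictMono.injective h
  simpa using h'

lemma expNeg_add (a b : ℝ≥0∞) : expNeg (a + b) = expNeg a * expNeg b := by
  rw [expNeg, expNeg, expNeg, ← ENNReal.toReal_mul, ← EReal.exp_add, EReal.coe_ennreal_add,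
    EReal.neg_add (Or.inl (by simp)) (Or.inr (by simp)), sub_eq_add_neg]

/-- Midpoints become geometric means, so with `u`, `v`, `w` the values at `a`, `b` and the midpoint,
`(u - v)² = u² + v² - 2w²`: an exact convexity identity, valid at `∞` too. -/
lemma expNeg_midpoint_sq (a b : ℝ≥0∞) :
    expNeg ((a + b) / 2) ^ 2 = expNeg a * expNeg b := by
  rw [sq, ← expNeg_add, ENNReal.add_halves, expNeg_add]

lemma tendsto_of_tendsto_expNeg {t : ℕ → ℝ≥0∞} {l : ℝ}
    (h : Tendsto (fun n => expNeg (t n)) atTop (𝓝 l)) : ∃ s, Tendsto t atTop (𝓝 s) := by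
  have he : Topology.IsClosedEmbedding expNeg :=
    continuous_expNeg.isClosedEmbedding expNeg_injective
  obtain ⟨s, rfl⟩ : l ∈ Set.range expNeg :=
    he.isClosed_range.mem_of_tendsto h (Eventually.of_forall fun n => ⟨t n, rfl⟩)
  exact ⟨s, he.isInducing.tendsto_nhds_iff.2 h⟩

/-- The weights `4 ^ n` leave a summable series of integrals, so almost everywhere the increments
are bounded by a constant times `2 ^ (-n)`. -/
lemma ae_exists_tendsto_of_lintegral_sq_le {α : Type*} [MeasurableSpace α] {μ : Measure α}
    {u : ℕ → α → ℝ} (hu : ∀ n, Measurable (u n)) {C : ℝ}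
    (h : ∀ n, ∫⁻ x, ENNReal.ofReal ((u n x - u (n + 1) x) ^ 2) ∂μ
      ≤ ENNReal.ofReal (C * (1 / 8) ^ n)) :
    ∀ᵐ x ∂μ, ∃ l, Tendsto (fun n => u n x) atTop (𝓝 l) := by
  have hm : ∀ n, Measurable fun x => ENNReal.ofReal (4 ^ n * (u n x - u (n + 1) x) ^ 2) :=
    fun n => (measurable_const.mul (((hu n).sub (hu (n + 1))).pow_const 2)).ennreal_ofReal
  have hC : ∀ n, ∫⁻ x, ENNReal.ofReal (4 ^ n * (u n x - u (n + 1) x) ^ 2) ∂μ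
      ≤ ENNReal.ofReal (|C| * (1 / 2) ^ n) := by
    intro n
    simp_rw [ENNReal.ofReal_mul (show (0 : ℝ) ≤ 4 ^ n by positivity)]
    rw [lintegral_const_mul' _ _ ENNReal.ofReal_ne_top]
    calc _ ≤ ENNReal.ofReal (4 ^ n) * ENNReal.ofReal (C * (1 / 8) ^ n) := by gcongr; exact h n
      _ = ENNReal.ofReal (C * (1 / 2) ^ n) := by
        rw [← ENNReal.ofReal_mul (by positivity)]
        congr 1
        rw [mul_left_comm, ← mul_pow]; norm_num
      _ ≤ _ := by gcongr; exact le_abs_self C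
  have hsum : ∫⁻ x, ∑' n, ENNReal.ofReal (4 ^ n * (u n x - u (n + 1) x) ^ 2) ∂μ ≠ ∞ := by
    rw [lintegral_tsum fun n => (hm n).aemeasurable]
    refine ne_top_of_le_ne_top ?_ (ENNReal.tsum_le_tsum hC)
    rw [← ENNReal.ofReal_tsum_of_nonneg (fun n => by positivity)
      (summable_geometric_two.mul_left _)]
    exact ENNReal.ofReal_ne_top
  filter_upwards [ae_lt_top (Measurable.tsum hm) hsum] with x hx
  set D := ∑' n, ENNReal.ofReal (4 ^ n * (u n x - u (n + 1) x) ^ 2) with hD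
  have hle : ∀ n, 4 ^ n * (u n x - u (n + 1) x) ^ 2 ≤ D.toReal := fun n =>
    (ENNReal.ofReal_le_iff_le_toReal hx.ne).1 (ENNReal.le_tsum n)
  refine cauchySeq_tendsto_of_complete
    (cauchySeq_of_le_geometric (1 / 2) (√D.toReal) (by norm_num) fun n => ?_)
  rw [Real.dist_eq]
  refine abs_le_of_sq_le_sq ?_ (by positivity)
  rw [mul_pow, Real.sq_sqrt ENNReal.toReal_nonneg, ← pow_mul, mul_comm n 2, pow_mul]
  have := hle n
  have h4 : (4 : ℝ) ^ n * ((1 / 2) ^ 2) ^ n = 1 := by rw [← mul_pow]; norm_num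
  nlinarith [pow_pos (show (0 : ℝ) < (1 / 2) ^ 2 by norm_num) n]

/-- A minimising selection from a decreasing sequence of sets. -/
lemma exists_minimising_selection {P : Type*} {S : ℕ → Set P} (hS : Antitone S)
    (hne : ∀ n, (S n).Nonempty) {J : P → ℝ} {C : ℝ} (h0 : ∀ p, 0 ≤ J p) (hC : ∀ p, J p ≤ C)
    {δ : ℕ → ℝ} (hδ : ∀ n, 0 < δ n) (hδ' : Antitone δ) :
    ∃ (k : ℕ → ℕ) (p : ℕ → P), StrictMono k ∧ (∀ n, p n ∈ S (k n)) ∧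
      ∀ n, ∀ q ∈ S (k n), J (p n) + J (p (n + 1)) ≤ 2 * J q + 4 * δ n := by
  have hbdd : ∀ n, BddBelow (J '' S n) := fun n => ⟨0, by rintro _ ⟨p, -, rfl⟩; exact h0 p⟩
  set m : ℕ → ℝ := fun n => sInf (J '' S n) with hm
  have hmono : Monotone m := fun a b hab =>
    csInf_le_csInf (hbdd a) ((hne b).image J) (Set.image_mono (hS hab))
  have hmC : BddAbove (Set.range m) := by
    refine ⟨C, ?_⟩
    rintro _ ⟨n, rfl⟩
    obtain ⟨p, hp⟩ := hne n
    exact (csInf_le (hbdd n) ⟨p, hp, rfl⟩).trans (hC p)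
  have ht := tendsto_atTop_ciSup hmono hmC
  set L := ⨆ n, m n
  -- The infima increase to `L`. Every `q ∈ S (k n)` then has `J q > L - δ n`, while `p n` is chosen
  -- with `J (p n) < L + δ n`.
  obtain ⟨k, hk, hkL⟩ := extraction_forall_of_eventually
    (P := fun n j => L - δ n < m j)
    fun n => ht.eventually (lt_mem_nhds (show L - δ n < L by linarith [hδ n]))
  have hp : ∀ n, ∃ p ∈ S (k n), J p < L + δ n := by
    intro n
    have : m (k n) < L + δ n := by linarith [le_ciSup hmC (k n), hδ n]
    obtain ⟨_, ⟨p, hp, rfl⟩, h⟩ := exists_lt_of_csInf_lt ((hne (k n)).image J) this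
    exact ⟨p, hp, h⟩
  choose p hp hpJ using hp
  refine ⟨k, p, hk, hp, fun n q hq => ?_⟩
  have h1 : m (k n) ≤ J q := csInf_le (hbdd _) ⟨q, hq, rfl⟩
  linarith [hkL n, hpJ n, hpJ (n + 1), hδ' (Nat.le_succ n)]

/-! ### Upward continuity of the dual value -/

section Dominating

variable {Ω X Y : Type*} [MeasurableSpace X] [MeasurableSpace Y]

/-- The pairs of measurable `φ : X → [0, ∞]`, `ψ : Y → [0, ∞]` with `h ≤ φ ∘ e₀ + ψ ∘ e₁`
on `A`. -/
def dominating (e₀ : Ω → X) (e₁ : Ω → Y) (h : Ω → ℝ≥0∞) (A : Set Ω) :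
    Set ((X → ℝ≥0∞) × (Y → ℝ≥0∞)) :=
  {p | Measurable p.1 ∧ Measurable p.2 ∧ ∀ ω ∈ A, h ω ≤ p.1 (e₀ ω) + p.2 (e₁ ω)}

/-- The sum of the integrals of a pair of functions. -/
noncomputable def pairIntegral (μ : Measure X) (ν : Measure Y)
    (p : (X → ℝ≥0∞) × (Y → ℝ≥0∞)) : ℝ≥0∞ :=
  ∫⁻ x, p.1 x ∂μ + ∫⁻ y, p.2 y ∂ν

lemma integrable_mul_expNeg {α : Type*} [MeasurableSpace α] (μ : Measure α) [IsFiniteMeasure μ]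
    {φ φ' : α → ℝ≥0∞} (hφ : Measurable φ) (hφ' : Measurable φ') :
    Integrable (fun x => expNeg (φ x) * expNeg (φ' x)) μ := by
  refine Integrable.of_bound (C := 1) ((continuous_expNeg.measurable.comp hφ).mul
    (continuous_expNeg.measurable.comp hφ')).aestronglyMeasurable (Eventually.of_forall fun x => ?_)
  rw [Real.norm_of_nonneg (mul_nonneg (expNeg_nonneg _) (expNeg_nonneg _))]
  exact mul_le_one₀ (expNeg_le_one _) (expNeg_nonneg _) (expNeg_le_one _)

lemma integral_sq_expNeg_le {α : Type*} [MeasurableSpace α] (μ : Measure α) [IsFiniteMeasure μ]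
    (φ : α → ℝ≥0∞) : ∫ x, expNeg (φ x) ^ 2 ∂μ ≤ μ.real Set.univ := by
  have h : ∀ x, ‖expNeg (φ x) ^ 2‖ ≤ 1 := fun x => by
    rw [Real.norm_of_nonneg (sq_nonneg _)]
    exact pow_le_one₀ (expNeg_nonneg _) (expNeg_le_one _)
  refine (le_abs_self _).trans ?_
  simpa using norm_integral_le_of_norm_le_const (μ := μ) (Eventually.of_forall h)

lemma integrable_sq_sub_expNeg {α : Type*} [MeasurableSpace α] (μ : Measure α)
    [IsFiniteMeasure μ] {φ φ' : α → ℝ≥0∞} (hφ : Measurable φ) (hφ' : Measurable φ') :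
    Integrable (fun x => (expNeg (φ x) - expNeg (φ' x)) ^ 2) μ := by
  have h := ((integrable_mul_expNeg μ hφ hφ).add (integrable_mul_expNeg μ hφ' hφ')).sub
    ((integrable_mul_expNeg μ hφ hφ').const_mul 2)
  refine h.congr (Eventually.of_forall fun x => ?_)
  simp only [Pi.add_apply, Pi.sub_apply]
  ring

lemma integral_sq_sub_expNeg {α : Type*} [MeasurableSpace α] (μ : Measure α) [IsFiniteMeasure μ]
    {φ φ' : α → ℝ≥0∞} (hφ : Measurable φ) (hφ' : Measurable φ') :
    ∫ x, (expNeg (φ x) - expNeg (φ' x)) ^ 2 ∂μ =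
      ∫ x, expNeg (φ x) ^ 2 ∂μ + ∫ x, expNeg (φ' x) ^ 2 ∂μ -
        2 * ∫ x, expNeg ((φ x + φ' x) / 2) ^ 2 ∂μ := by
  simp_rw [expNeg_midpoint_sq]
  have h1 := integrable_mul_expNeg μ hφ hφ
  have h2 := integrable_mul_expNeg μ hφ' hφ'
  have h3 := integrable_mul_expNeg μ hφ hφ'
  rw [← integral_const_mul, ← integral_add (by simpa only [sq] using h1)
    (by simpa only [sq] using h2), ← integral_sub]
  · congr 1 with x; ring
  · simp only [sq]
    exact h1.add h2
  · exact h3.const_mul 2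

lemma lintegral_midpoint {α : Type*} [MeasurableSpace α] (μ : Measure α) {φ φ' : α → ℝ≥0∞}
    (hφ : Measurable φ) :
    ∫⁻ x, (φ x + φ' x) / 2 ∂μ = (∫⁻ x, φ x ∂μ + ∫⁻ x, φ' x ∂μ) / 2 := by
  simp_rw [div_eq_mul_inv]
  rw [lintegral_mul_const' _ _ (by simp), lintegral_add_left hφ]

/-- The value `∞` on the exceptional null set costs nothing in the integral and makes domination
trivial there, so that it can be kept at every point. -/
lemma exists_liminf_top_off_null {α : Type*} [MeasurableSpace α] {μ : Measure α}
    {φ : ℕ → α → ℝ≥0∞} (hφ : ∀ n, Measurable (φ n))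
    (h : ∀ᵐ x ∂μ, ∃ l, Tendsto (fun n => expNeg (φ n x)) atTop (𝓝 l)) :
    ∃ Φ : α → ℝ≥0∞, Measurable Φ ∧ (Φ =ᵐ[μ] fun x => liminf (fun n => φ n x) atTop) ∧
      ∀ x, Φ x = ∞ ∨ Tendsto (fun n => φ n x) atTop (𝓝 (Φ x)) := by
  classical
  obtain ⟨s, hsub, hs, hs0⟩ := exists_measurable_superset_of_null (ae_iff.1 h)
  refine ⟨s.piecewise (fun _ => ∞) fun x => liminf (fun n => φ n x) atTop,
    Measurable.piecewise hs measurable_const (Measurable.liminf hφ), ?_, fun x => ?_⟩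
  · filter_upwards [measure_eq_zero_iff_ae_notMem.1 hs0] with x hx
    simp [hx]
  · by_cases hx : x ∈ s
    · simp [hx]
    · right
      have : ∃ l, Tendsto (fun n => expNeg (φ n x)) atTop (𝓝 l) := by
        by_contra hcon
        exact hx (hsub hcon)
      obtain ⟨l, hl⟩ := this
      obtain ⟨t, ht⟩ := tendsto_of_tendsto_expNeg hl
      simpa [hx, ht.liminf_eq] using ht

/-- Upward continuity of the dual value. -/
theorem exists_dominating_iUnion {e₀ : Ω → X} {e₁ : Ω → Y} {h : Ω → ℝ≥0∞}
    (μ : Measure X) (ν : Measure Y) [IsFiniteMeasure μ] [IsFiniteMeasure ν]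
    {A : ℕ → Set Ω} (hA : Monotone A) {a : ℝ≥0∞}
    (hex : ∀ n, ∃ p ∈ dominating e₀ e₁ h (A n), pairIntegral μ ν p ≤ a) :
    ∃ p ∈ dominating e₀ e₁ h (⋃ n, A n), pairIntegral μ ν p ≤ a := by
  set S : ℕ → Set ((X → ℝ≥0∞) × (Y → ℝ≥0∞)) := fun n =>
    {p | p ∈ dominating e₀ e₁ h (A n) ∧ pairIntegral μ ν p ≤ a} with hSdef
  have hS : Antitone S := fun m n hmn p hp =>
    ⟨⟨hp.1.1, hp.1.2.1, fun ω hω => hp.1.2.2 ω (hA hmn hω)⟩, hp.2⟩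
  -- `J` is bounded on all pairs, and its convexity defect at a midpoint is the squared `L²`
  -- distance of the exponentials.
  set J : (X → ℝ≥0∞) × (Y → ℝ≥0∞) → ℝ := fun p =>
    ∫ x, expNeg (p.1 x) ^ 2 ∂μ + ∫ y, expNeg (p.2 y) ^ 2 ∂ν with hJ
  obtain ⟨k, p, hk, hp, hq⟩ := exists_minimising_selection hS
    (fun n => let ⟨p, h1, h2⟩ := hex n; ⟨p, h1, h2⟩) (J := J)
    (C := μ.real Set.univ + ν.real Set.univ)
    (fun p => add_nonneg (integral_nonneg fun _ => sq_nonneg _)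
      (integral_nonneg fun _ => sq_nonneg _))
    (fun p => add_le_add (integral_sq_expNeg_le μ _) (integral_sq_expNeg_le ν _)) (δ := fun n => (1 / 8) ^ n)
    (fun n => by positivity) (fun m n hmn => pow_le_pow_of_le_one (by norm_num) (by norm_num) hmn)
  have hest : ∀ n, ∫ x, (expNeg ((p n).1 x) - expNeg ((p (n + 1)).1 x)) ^ 2 ∂μ +
      ∫ x, (expNeg ((p n).2 x) - expNeg ((p (n + 1)).2 x)) ^ 2 ∂ν ≤ 4 * (1 / 8) ^ n := by
    intro n
    have h1 := hp n
    have h2 := hS (hk.monotone n.le_succ) (hp (n + 1))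
    -- The sets `S` decrease, so `p (n + 1)` also lies in the convex set `S (k n)`; the midpoint is
    -- thus a competitor for `J`.
    have hmid : (fun x => ((p n).1 x + (p (n + 1)).1 x) / 2,
        fun y => ((p n).2 y + (p (n + 1)).2 y) / 2) ∈ S (k n) := by
      refine ⟨⟨(h1.1.1.add h2.1.1).div_const _, (h1.1.2.1.add h2.1.2.1).div_const _,
        fun ω hω => ?_⟩, ?_⟩
      · have := add_le_add (h1.1.2.2 ω hω) (h2.1.2.2 ω hω)
        calc h ω = (h ω + h ω) / 2 := by rw [ENNReal.add_div, ENNReal.add_halves]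
          _ ≤ _ := ENNReal.div_le_div_right this 2
          _ = _ := by rw [← ENNReal.add_div]; congr 1; ring
      · have := add_le_add h1.2 h2.2
        calc _ = (pairIntegral μ ν (p n) + pairIntegral μ ν (p (n + 1))) / 2 := by
              simp only [pairIntegral]
              rw [lintegral_midpoint μ h1.1.1, lintegral_midpoint ν h1.1.2.1, ← ENNReal.add_div]
              congr 1; ring
          _ ≤ (a + a) / 2 := ENNReal.div_le_div_right this 2
          _ = a := by rw [ENNReal.add_div, ENNReal.add_halves]
    have := hq n _ hmid
    rw [integral_sq_sub_expNeg μ h1.1.1 h2.1.1, integral_sq_sub_expNeg ν h1.1.2.1 h2.1.2.1]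
    simp only [hJ] at this
    linarith
  have hpm : ∀ n, Measurable (p n).1 := fun n => (hp n).1.1
  have hpm' : ∀ n, Measurable (p n).2 := fun n => (hp n).1.2.1
  have hx : ∀ᵐ x ∂μ, ∃ l, Tendsto (fun n => expNeg ((p n).1 x)) atTop (𝓝 l) := by
    refine ae_exists_tendsto_of_lintegral_sq_le
      (fun n => continuous_expNeg.measurable.comp (hpm n)) (C := 4) fun n => ?_
    rw [← ofReal_integral_eq_lintegral_ofReal (integrable_sq_sub_expNeg μ (hpm n) (hpm (n + 1)))
      (Eventually.of_forall fun _ => sq_nonneg _)]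
    exact ENNReal.ofReal_le_ofReal
      ((le_add_of_nonneg_right (integral_nonneg fun _ => sq_nonneg _)).trans (hest n))
  have hy : ∀ᵐ y ∂ν, ∃ l, Tendsto (fun n => expNeg ((p n).2 y)) atTop (𝓝 l) := by
    refine ae_exists_tendsto_of_lintegral_sq_le
      (fun n => continuous_expNeg.measurable.comp (hpm' n)) (C := 4) fun n => ?_
    rw [← ofReal_integral_eq_lintegral_ofReal (integrable_sq_sub_expNeg ν (hpm' n) (hpm' (n + 1)))
      (Eventually.of_forall fun _ => sq_nonneg _)]
    exact ENNReal.ofReal_le_ofReal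
      ((le_add_of_nonneg_left (integral_nonneg fun _ => sq_nonneg _)).trans (hest n))
  obtain ⟨φ, hφm, hφ, hφt⟩ := exists_liminf_top_off_null hpm hx
  obtain ⟨ψ, hψm, hψ, hψt⟩ := exists_liminf_top_off_null hpm' hy
  refine ⟨(φ, ψ), ⟨hφm, hψm, fun ω hω => ?_⟩, ?_⟩
  · rcases hφt (e₀ ω) with h0 | h0
    · simp [h0]
    rcases hψt (e₁ ω) with h1 | h1
    · simp [h1]
    obtain ⟨m, hm⟩ := Set.mem_iUnion.1 hω
    refine ge_of_tendsto (h0.add h1) ?_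
    filter_upwards [eventually_ge_atTop m] with n hn
    exact (hp n).1.2.2 ω (hA (hn.trans (hk.id_le n)) hm)
  · calc ∫⁻ x, φ x ∂μ + ∫⁻ y, ψ y ∂ν
        ≤ liminf (fun n => ∫⁻ x, (p n).1 x ∂μ) atTop + liminf (fun n => ∫⁻ y, (p n).2 y ∂ν) atTop :=
          add_le_add ((lintegral_congr_ae hφ).trans_le (lintegral_liminf_le hpm))
            ((lintegral_congr_ae hψ).trans_le (lintegral_liminf_le hpm'))
      _ ≤ liminf (fun n => pairIntegral μ ν (p n)) atTop := by
        simp only [liminf_eq_iSup_iInf_of_nat, pairIntegral]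
        rw [ENNReal.iSup_add_iSup_of_monotone
          (fun m n h => biInf_mono fun i hi => h.trans hi)
          (fun m n h => biInf_mono fun i hi => h.trans hi)]
        exact iSup_mono fun n => le_iInf₂ fun i hi => add_le_add (iInf₂_le i hi) (iInf₂_le i hi)
      _ ≤ a := by
        refine (liminf_le_liminf (Eventually.of_forall fun n => (hp n).2)).trans ?_
        simp

end Dominating

/-! ### Extraction of a compact set -/

/-- A sequence that lies eventually in finitely many balls of every radius has a cluster point. -/
lemma exists_mapClusterPt_of_eventually_mem_balls {Ω : Type*} [MetricSpace Ω] [CompleteSpace Ω]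
    {γ : ℕ → Ω} (h : ∀ ε > 0, ∃ t : Set Ω, t.Finite ∧
      ∀ᶠ k in atTop, γ k ∈ ⋃ x ∈ t, Metric.closedBall x ε) :
    ∃ x, MapClusterPt x atTop γ := by
  let F : Ultrafilter Ω := (hyperfilter ℕ).map γ
  have hF : ∀ s, (∀ᶠ k in atTop, γ k ∈ s) → s ∈ F := fun s hs =>
    (Nat.hyperfilter_le_atTop : (hyperfilter ℕ : Filter ℕ) ≤ atTop) hs
  have hc : Cauchy (F : Filter Ω) := by
    refine Metric.cauchy_iff.2 ⟨F.neBot, fun ε hε => ?_⟩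
    -- An ultrafilter containing a finite union of balls contains one of them; hence it is Cauchy.
    obtain ⟨t, ht, hk⟩ := h (ε / 3) (by positivity)
    obtain ⟨x, -, hx⟩ := (Ultrafilter.finite_biUnion_mem_iff ht).1 (hF _ hk)
    refine ⟨_, hx, fun y hy z hz => ?_⟩
    have := dist_triangle_right y z x
    rw [Metric.mem_closedBall] at hy hz
    linarith
  obtain ⟨x, hx⟩ := CompleteSpace.complete hc
  refine ⟨x, ?_⟩
  rw [MapClusterPt, ClusterPt]
  have hle : (F : Filter Ω) ≤ 𝓝 x ⊓ map γ atTop :=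
    le_inf hx (fun s hs => hF s hs)
  exact neBot_of_le hle

/-- A capacity-like property of the sets in a Polish space is inherited by the neighbourhoods of
some compact set. -/
theorem exists_isCompact_forall_isOpen {Ω : Type*} [TopologicalSpace Ω] [PolishSpace Ω]
    {Big : Set Ω → Prop} (huniv : Big Set.univ)
    (hBig : ∀ A : ℕ → Set Ω, Monotone A → Big (⋃ n, A n) → ∃ n, Big (A n)) :
    ∃ K, IsCompact K ∧ ∀ U, IsOpen U → K ⊆ U → ∃ A, Big A ∧ A ⊆ U := by
  rcases isEmpty_or_nonempty Ω with hΩ | hΩ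
  · exact ⟨∅, isCompact_empty, fun U _ _ => ⟨Set.univ, huniv, fun x => isEmptyElim x⟩⟩
  let := TopologicalSpace.upgradeIsCompletelyMetrizable Ω
  set d := TopologicalSpace.denseSeq Ω
  have hd : DenseRange d := TopologicalSpace.denseRange_denseSeq Ω
  set B : ℕ → ℕ → Set Ω := fun k m =>
    ⋃ x ∈ d '' Set.Iic m, Metric.closedBall x (1 / ((k : ℝ) + 1)) with hB
  have hBclosed : ∀ k m, IsClosed (B k m) := fun k m =>
    ((Set.finite_Iic m).image d).isClosed_biUnion fun x _ => Metric.isClosed_closedBall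
  have hBmono : ∀ k, Monotone (B k) := fun k m n hmn =>
    Set.biUnion_subset_biUnion_left (Set.image_mono (Set.Iic_subset_Iic.2 hmn))
  have hBU : ∀ k, ⋃ m, B k m = Set.univ := by
    intro k
    refine Set.eq_univ_of_forall fun x => ?_
    obtain ⟨m, hm⟩ := hd.exists_dist_lt x (show (0 : ℝ) < 1 / ((k : ℝ) + 1) by positivity)
    exact Set.mem_iUnion.2 ⟨m, Set.mem_biUnion ⟨m, Set.mem_Iic.2 le_rfl, rfl⟩ hm.le⟩
  -- Finite unions of balls of a fixed radius exhaust the space, so intersecting with one of them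
  -- can keep a set big.
  have hstep : ∀ (k : ℕ) (A : {A : Set Ω // Big A}),
      ∃ A' : {A : Set Ω // Big A}, ∃ m, A'.1 = A.1 ∩ B k m := by
    rintro k ⟨A, hA⟩
    obtain ⟨m, hm⟩ := hBig (fun m => A ∩ B k m)
      (fun m n hmn => Set.inter_subset_inter_right _ (hBmono k hmn))
      (by rwa [← Set.inter_iUnion, hBU, Set.inter_univ])
    exact ⟨⟨_, hm⟩, m, rfl⟩
  choose next m hnext using hstep
  let F : ℕ → {A : Set Ω // Big A} := fun n => Nat.rec ⟨Set.univ, huniv⟩ next n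
  have hFsucc : ∀ n, (F (n + 1)).1 = (F n).1 ∩ B n (m n (F n)) := fun n => hnext n (F n)
  have hFanti : Antitone fun n => (F n).1 := antitone_nat_of_succ_le fun n => by
    rw [hFsucc]; exact Set.inter_subset_left
  have hFclosed : ∀ n, IsClosed (F n).1 := by
    intro n
    induction n with
    | zero => exact isClosed_univ
    | succ n ih => rw [hFsucc]; exact ih.inter (hBclosed _ _)
  have hcover : ∀ ε > 0, ∃ t : Set Ω, t.Finite ∧ ∃ n, (F n).1 ⊆ ⋃ x ∈ t, Metric.closedBall x ε := by
    intro ε hε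
    obtain ⟨k, hk⟩ := exists_nat_one_div_lt hε
    refine ⟨d '' Set.Iic (m k (F k)), (Set.finite_Iic _).image d, k + 1, ?_⟩
    rw [hFsucc]
    exact Set.inter_subset_right.trans
      (Set.iUnion₂_mono fun x _ => Metric.closedBall_subset_closedBall hk.le)
  refine ⟨⋂ n, (F n).1, ?_, fun U hU hKU => ?_⟩
  · refine TotallyBounded.isCompact_of_isClosed ?_ (isClosed_iInter hFclosed)
    refine Metric.totallyBounded_iff.2 fun ε hε => ?_
    obtain ⟨t, ht, n, hn⟩ := hcover (ε / 2) (by positivity)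
    refine ⟨t, ht, ((Set.iInter_subset _ n).trans hn).trans (Set.iUnion₂_mono fun x _ => ?_)⟩
    exact Metric.closedBall_subset_ball (by linarith)
  -- Otherwise points of `F n` outside `U` can be chosen. They have a cluster point, which lies in
  -- every closed `F n` and outside `U`. `Big` itself need not pass to the intersection.
  · by_contra! hcon
    have hex : ∀ n, ∃ x, x ∈ (F n).1 ∧ x ∉ U := fun n =>
      Set.not_subset.1 (hcon (F n).1 (F n).2)
    choose γ hγ hγU using hex
    obtain ⟨x, hx⟩ := exists_mapClusterPt_of_eventually_mem_balls (γ := γ) fun ε hε => by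
      obtain ⟨t, ht, n, hn⟩ := hcover ε hε
      refine ⟨t, ht, ?_⟩
      filter_upwards [eventually_ge_atTop n] with k hk
      exact hn (hFanti hk (hγ k))
    have hmem : ∀ s : Set Ω, IsClosed s → (∀ᶠ n in atTop, γ n ∈ s) → x ∈ s := fun s hs h =>
      isClosed_iff_clusterPt.1 hs x (hx.clusterPt.mono (le_principal_iff.2 h))
    refine hmem Uᶜ hU.isClosed_compl (Eventually.of_forall hγU) (hKU (Set.mem_iInter.2 fun n => ?_))
    refine hmem _ (hFclosed n) ?_
    filter_upwards [eventually_ge_atTop n] with k hk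
    exact hFanti hk (hγ k)

/-! ### Duality on a compact space by Hahn-Banach and Riesz -/

/-- A sublinear functional is attained at a given vector by a linear functional below it. -/
lemma exists_linear_le_sublinear_eq {E : Type*} [AddCommGroup E] [Module ℝ E] (N : E → ℝ)
    (N_hom : ∀ c : ℝ, 0 < c → ∀ x, N (c • x) = c * N x)
    (N_add : ∀ x y, N (x + y) ≤ N x + N y) (x : E) :
    ∃ g : E →ₗ[ℝ] ℝ, g x = N x ∧ ∀ y, g y ≤ N y := by
  have N0 : N 0 = 0 := by
    have := N_hom 2 (by norm_num) 0
    rw [smul_zero] at this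
    linarith
  have H : ∀ c : ℝ, c • x = 0 → RingHom.id ℝ c • N x = 0 := fun c hc => by
    rcases smul_eq_zero.1 hc with rfl | rfl <;> simp [N0]
  have hle : ∀ z : (LinearPMap.mkSpanSingleton' x (N x) H).domain,
      LinearPMap.mkSpanSingleton' x (N x) H z ≤ N z := by
    rintro ⟨y, hy⟩
    obtain ⟨c, rfl⟩ := Submodule.mem_span_singleton.1 hy
    rw [LinearPMap.mkSpanSingleton'_apply, RingHom.id_apply, smul_eq_mul]
    rcases lt_trichotomy c 0 with hc | rfl | hc
    · have h1 := N_hom (-c) (by linarith) x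
      have h2 := N_add (c • x) (-c • x)
      rw [← add_smul, add_neg_cancel, zero_smul, N0] at h2
      linarith
    · simp [N0]
    · rw [N_hom c hc]
  obtain ⟨g, hg, hgN⟩ := exists_extension_of_le_sublinear _ N N_hom N_add hle
  refine ⟨g, ?_, hgN⟩
  have hx : x ∈ (LinearPMap.mkSpanSingleton' x (N x) H).domain :=
    Submodule.mem_span_singleton_self x
  exact (hg ⟨x, hx⟩).trans (LinearPMap.mkSpanSingleton'_apply_self x (N x) H hx)

/-- Closed sets are limits of bounded continuous functions from above, and finite measures are inner
regular for closed sets. -/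
lemma measure_le_of_forall_lintegral_le {X : Type*} [TopologicalSpace X]
    [TopologicalSpace.PseudoMetrizableSpace X] [MeasurableSpace X] [BorelSpace X]
    {μ ν : Measure X} [IsFiniteMeasure μ] [IsFiniteMeasure ν]
    (h : ∀ f : X →ᵇ ℝ≥0, ∫⁻ x, f x ∂μ ≤ ∫⁻ x, f x ∂ν) : μ ≤ ν := by
  refine Measure.le_iff.2 fun s hs => ?_
  rw [hs.measure_eq_iSup_isClosed_of_ne_top (measure_ne_top μ s)]
  refine iSup₂_le fun F hFs => iSup_le fun hF => ?_
  refine le_trans ?_ (measure_mono hFs)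
  refine ge_of_tendsto' (HasOuterApproxClosed.tendsto_lintegral_apprSeq hF ν) fun n => ?_
  exact (HasOuterApproxClosed.measure_le_lintegral hF μ n).trans (h _)

/-- A positive linear functional on the continuous functions of a compact space is the integral
against a finite measure. -/
lemma exists_measure_integral_eq {K : Type*} [TopologicalSpace K] [CompactSpace K] [T2Space K]
    [MeasurableSpace K] [BorelSpace K] (g : C(K, ℝ) →ₗ[ℝ] ℝ) (hg : ∀ u, 0 ≤ u → 0 ≤ g u) :
    ∃ π : Measure K, IsFiniteMeasure π ∧ ∀ u : C(K, ℝ), ∫ k, u k ∂π = g u := by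
  let ι : CompactlySupportedContinuousMap K ℝ →ₗ[ℝ] C(K, ℝ) :=
    { toFun := fun u => u.toContinuousMap
      map_add' := fun _ _ => rfl
      map_smul' := fun _ _ => rfl }
  let Λ : CompactlySupportedContinuousMap K ℝ →ₚ[ℝ] ℝ :=
    PositiveLinearMap.mk₀ (g.comp ι) fun u hu => hg _ fun x => hu x
  refine ⟨RealRMK.rieszMeasure Λ, inferInstance, fun u => ?_⟩
  exact RealRMK.integral_rieszMeasure Λ (CompactlySupportedContinuousMap.continuousMapEquiv u)

lemma BoundedContinuousFunction.integrable_coe_nnreal {X : Type*} [TopologicalSpace X]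
    [MeasurableSpace X] [OpensMeasurableSpace X] (μ : Measure X) [IsFiniteMeasure μ]
    (φ : X →ᵇ ℝ≥0) : Integrable (fun x => (φ x : ℝ)) μ := by
  refine Integrable.of_bound (C := nndist φ 0)
    (NNReal.continuous_coe.comp φ.continuous).measurable.aestronglyMeasurable
    (Eventually.of_forall fun x => ?_)
  have := BoundedContinuousFunction.NNReal.upper_bound φ x
  rw [NNReal.norm_eq]
  exact_mod_cast this

lemma BoundedContinuousFunction.lintegral_eq_ofReal_integral {X : Type*} [TopologicalSpace X]
    [MeasurableSpace X] [OpensMeasurableSpace X] (μ : Measure X) [IsFiniteMeasure μ]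
    (φ : X →ᵇ ℝ≥0) : ∫⁻ x, φ x ∂μ = ENNReal.ofReal (∫ x, (φ x : ℝ) ∂μ) := by
  rw [ofReal_integral_eq_lintegral_ofReal (φ.integrable_coe_nnreal μ)
    (Eventually.of_forall fun x => (φ x).2)]
  simp

section CompactDuality

variable {K X Y : Type*} [TopologicalSpace K] [TopologicalSpace X] [MeasurableSpace X]
  [TopologicalSpace Y] [MeasurableSpace Y]

/-- The values of the bounded continuous pairs that dominate `u` on `K`. -/
def dominatingValues (e₀ : C(K, X)) (e₁ : C(K, Y)) (μ : Measure X) (ν : Measure Y)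
    (u : C(K, ℝ)) : Set ℝ :=
  {r | ∃ (φ : X →ᵇ ℝ≥0) (ψ : Y →ᵇ ℝ≥0), (∀ k, u k ≤ φ (e₀ k) + ψ (e₁ k)) ∧
    r = ∫ x, (φ x : ℝ) ∂μ + ∫ y, (ψ y : ℝ) ∂ν}

variable {e₀ : C(K, X)} {e₁ : C(K, Y)} {μ : Measure X} {ν : Measure Y}

lemma nonneg_of_mem_dominatingValues {u : C(K, ℝ)} {r : ℝ}
    (hr : r ∈ dominatingValues e₀ e₁ μ ν u) : 0 ≤ r := by
  obtain ⟨φ, ψ, -, rfl⟩ := hr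
  exact add_nonneg (integral_nonneg fun x => (φ x).2) (integral_nonneg fun x => (ψ x).2)

lemma bddBelow_dominatingValues (u : C(K, ℝ)) : BddBelow (dominatingValues e₀ e₁ μ ν u) :=
  ⟨0, fun _ hr => nonneg_of_mem_dominatingValues hr⟩

lemma dominatingValues_nonempty [CompactSpace K] (u : C(K, ℝ)) : (dominatingValues e₀ e₁ μ ν u).Nonempty := by
  refine ⟨_, BoundedContinuousFunction.const X ‖u‖₊, 0, fun k => ?_, rfl⟩
  simpa using (le_abs_self _).trans (u.norm_coe_le_norm k)

lemma smul_mem_dominatingValues {u : C(K, ℝ)} {r c : ℝ} (hc : 0 ≤ c)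
    (hr : r ∈ dominatingValues e₀ e₁ μ ν u) : c * r ∈ dominatingValues e₀ e₁ μ ν (c • u) := by
  obtain ⟨φ, ψ, h, rfl⟩ := hr
  lift c to ℝ≥0 using hc
  refine ⟨c • φ, c • ψ, fun k => ?_, ?_⟩
  · have := mul_le_mul_of_nonneg_left (h k) c.2
    simpa [NNReal.smul_def, mul_add] using this
  · simp [integral_const_mul, mul_add]

lemma add_mem_dominatingValues [OpensMeasurableSpace X] [OpensMeasurableSpace Y]
    [IsFiniteMeasure μ] [IsFiniteMeasure ν] {u v : C(K, ℝ)} {r s : ℝ}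
    (hr : r ∈ dominatingValues e₀ e₁ μ ν u) (hs : s ∈ dominatingValues e₀ e₁ μ ν v) :
    r + s ∈ dominatingValues e₀ e₁ μ ν (u + v) := by
  obtain ⟨φ, ψ, h, rfl⟩ := hr
  obtain ⟨φ', ψ', h', rfl⟩ := hs
  refine ⟨φ + φ', ψ + ψ', fun k => ?_, ?_⟩
  · have := add_le_add (h k) (h' k)
    simp only [ContinuousMap.add_apply, BoundedContinuousFunction.add_apply, NNReal.coe_add]
    linarith
  · simp only [BoundedContinuousFunction.add_apply, NNReal.coe_add]
    rw [integral_add (φ.integrable_coe_nnreal μ) (φ'.integrable_coe_nnreal μ),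
      integral_add (ψ.integrable_coe_nnreal ν) (ψ'.integrable_coe_nnreal ν)]
    ring

/-- Duality on a compact space, with marginals that are only bounded from above. -/
theorem exists_measure_map_le_of_compact [CompactSpace K] [T2Space K] [MeasurableSpace K] [BorelSpace K]
    [BorelSpace X] [BorelSpace Y]
    [TopologicalSpace.PseudoMetrizableSpace X] [TopologicalSpace.PseudoMetrizableSpace Y]
    [IsFiniteMeasure μ] [IsFiniteMeasure ν] (h : C(K, ℝ)) {a : ℝ}
    (ha : ∀ r ∈ dominatingValues e₀ e₁ μ ν h, a ≤ r) :
    ∃ π : Measure K, IsFiniteMeasure π ∧ π.map e₀ ≤ μ ∧ π.map e₁ ≤ ν ∧ a ≤ ∫ k, h k ∂π := by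
  set N : C(K, ℝ) → ℝ := fun u => sInf (dominatingValues e₀ e₁ μ ν u) with hN
  have hle : ∀ {u r}, r ∈ dominatingValues e₀ e₁ μ ν u → N u ≤ r := fun hr =>
    csInf_le (bddBelow_dominatingValues _) hr
  have hhom : ∀ c : ℝ, 0 < c → ∀ u, N (c • u) ≤ c * N u := by
    intro c hc u
    rw [← div_le_iff₀' hc]
    refine le_csInf (dominatingValues_nonempty u) fun r hr => ?_
    rw [div_le_iff₀' hc]
    exact hle (smul_mem_dominatingValues hc.le hr)
  obtain ⟨g, hgh, hgN⟩ := exists_linear_le_sublinear_eq N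
    (fun c hc u => le_antisymm (hhom c hc u) (by
      have := hhom c⁻¹ (inv_pos.2 hc) (c • u)
      rwa [smul_smul, inv_mul_cancel₀ hc.ne', one_smul, ← div_eq_inv_mul, le_div_iff₀' hc] at this))
    (fun u v => by
      refine le_of_forall_pos_le_add fun ε hε => ?_
      obtain ⟨r, hr, hr'⟩ := exists_lt_of_csInf_lt (dominatingValues_nonempty u)
        (show N u < N u + ε / 2 by linarith)
      obtain ⟨s, hs, hs'⟩ := exists_lt_of_csInf_lt (dominatingValues_nonempty v)
        (show N v < N v + ε / 2 by linarith)
      linarith [hle (add_mem_dominatingValues hr hs)]) h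
  obtain ⟨π, hπ, hint⟩ := exists_measure_integral_eq g fun u hu => by
    -- The zero pair dominates `-u`; this makes `g` positive.
    have h0 : N (-u) ≤ 0 := hle ⟨0, 0, fun k => by simpa using hu k, by simp⟩
    have := (hgN (-u)).trans h0
    rw [map_neg] at this
    linarith
  refine ⟨π, hπ, ?_, ?_, ?_⟩
  · refine measure_le_of_forall_lintegral_le fun φ => ?_
    rw [φ.lintegral_eq_ofReal_integral (π.map e₀), φ.lintegral_eq_ofReal_integral μ]
    refine ENNReal.ofReal_le_ofReal ?_
    rw [integral_map e₀.continuous.measurable.aemeasurable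
      (φ.integrable_coe_nnreal _).aestronglyMeasurable]
    -- The pair `(φ, 0)` dominates `φ ∘ e₀`, so the marginal integrates `φ` to at most `∫ φ dμ`.
    have h1 := hint ⟨fun k => (φ (e₀ k) : ℝ), by fun_prop⟩
    refine h1.trans_le ((hgN _).trans (hle ⟨φ, 0, fun k => by simp, by simp⟩))
  · refine measure_le_of_forall_lintegral_le fun φ => ?_
    rw [φ.lintegral_eq_ofReal_integral (π.map e₁), φ.lintegral_eq_ofReal_integral ν]
    refine ENNReal.ofReal_le_ofReal ?_
    rw [integral_map e₁.continuous.measurable.aemeasurable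
      (φ.integrable_coe_nnreal _).aestronglyMeasurable]
    have h1 := hint ⟨fun k => (φ (e₁ k) : ℝ), by fun_prop⟩
    refine h1.trans_le ((hgN _).trans (hle ⟨0, φ, fun k => by simp, by simp⟩))
  · rw [hint, hgh]
    exact le_csInf (dominatingValues_nonempty h) ha

end CompactDuality

/-! ### Partial plans on standard Borel spaces -/

section PartialPlan

variable {Ω X Y : Type*} [MeasurableSpace Ω]
  [TopologicalSpace X] [TopologicalSpace.PseudoMetrizableSpace X] [MeasurableSpace X] [BorelSpace X]
  [TopologicalSpace Y] [TopologicalSpace.PseudoMetrizableSpace Y] [MeasurableSpace Y] [BorelSpace Y]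

lemma exists_measure_map_le_of_continuous [TopologicalSpace Ω] [PolishSpace Ω] [BorelSpace Ω]
    {e₀ : Ω → X} {e₁ : Ω → Y} {h : Ω → ℝ≥0} (he₀ : Continuous e₀) (he₁ : Continuous e₁)
    (hh : Continuous h) (μ : Measure X) (ν : Measure Y) [IsFiniteMeasure μ] [IsFiniteMeasure ν]
    {a : ℝ≥0∞} (ha : ∀ p ∈ dominating e₀ e₁ (fun ω => (h ω : ℝ≥0∞)) Set.univ,
      a < pairIntegral μ ν p) :
    ∃ π : Measure Ω, π.map e₀ ≤ μ ∧ π.map e₁ ≤ ν ∧ a ≤ ∫⁻ ω, h ω ∂π := by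
  have hatop : a ≠ ∞ :=
    (ha (fun _ => ∞, fun _ => ∞) ⟨measurable_const, measurable_const, by simp⟩).ne_top
  obtain ⟨K, hK, hKU⟩ := exists_isCompact_forall_isOpen
    (Big := fun A => ∀ p ∈ dominating e₀ e₁ (fun ω => (h ω : ℝ≥0∞)) A, a < pairIntegral μ ν p) ha
    (fun A hA hbig => by
      by_contra! hcon
      obtain ⟨p, hp, hpa⟩ := exists_dominating_iUnion μ ν hA hcon
      exact (hbig p hp).not_ge hpa)
  have : CompactSpace K := isCompact_iff_compactSpace.1 hK
  obtain ⟨π, hπ, h0, h1, h2⟩ := exists_measure_map_le_of_compact (K := K) (μ := μ) (ν := ν)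
    (e₀ := ⟨fun k => e₀ k, by fun_prop⟩) (e₁ := ⟨fun k => e₁ k, by fun_prop⟩)
    ⟨fun k => (h k : ℝ), by fun_prop⟩ (a := a.toReal) (by
      rintro _ ⟨φ, ψ, hφψ, rfl⟩
      refine ENNReal.toReal_le_of_le_ofReal
        (add_nonneg (integral_nonneg fun x => (φ x).coe_nonneg) (integral_nonneg fun x => (ψ x).coe_nonneg)) ?_
      rw [ENNReal.ofReal_add (integral_nonneg fun x => (φ x).coe_nonneg) (integral_nonneg fun x => (ψ x).coe_nonneg),
        ← φ.lintegral_eq_ofReal_integral μ, ← ψ.lintegral_eq_ofReal_integral ν]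
      refine ENNReal.le_of_forall_pos_le_add fun ε hε _ => ?_
      -- Adding `δ` to `φ` makes the domination on the compact set strict, hence valid on a
      -- neighbourhood, which contains a big set. The extra integral is at most `ε`.
      obtain ⟨δ, hδ, hδM⟩ : ∃ δ : ℝ≥0, 0 < δ ∧ δ * μ Set.univ ≤ ε := by
        lift μ Set.univ to ℝ≥0 using measure_ne_top μ _ with M
        refine ⟨ε / (M + 1), by positivity, ?_⟩
        norm_cast
        rw [div_mul_eq_mul_div, div_le_iff₀ (by positivity)]
        gcongr
        exact le_self_add
      obtain ⟨A, hA, hAU⟩ := hKU {ω | h ω < φ (e₀ ω) + ψ (e₁ ω) + δ}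
        (isOpen_lt hh (by fun_prop)) fun ω hω => by
          have : h ω ≤ φ (e₀ ω) + ψ (e₁ ω) := by exact_mod_cast hφψ ⟨ω, hω⟩
          exact this.trans_lt (lt_add_of_pos_right _ hδ)
      have := (hA (fun x => φ x + δ, fun y => ψ y) ⟨?_, ?_, fun ω hω => ?_⟩).le
      · refine this.trans ?_
        rw [pairIntegral, lintegral_add_right _ measurable_const, lintegral_const, add_right_comm]
        gcongr
      · exact (φ.continuous.measurable.coe_nnreal_ennreal).add_const _
      · exact ψ.continuous.measurable.coe_nnreal_ennreal
      · have h1 : h ω < φ (e₀ ω) + ψ (e₁ ω) + δ := hAU hω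
        have := h1.le
        rw [add_right_comm] at this
        dsimp only
        exact_mod_cast this)
  have hm : Measurable ((↑) : K → Ω) := measurable_subtype_coe
  refine ⟨π.map (↑), ?_, ?_, ?_⟩
  · rwa [Measure.map_map he₀.measurable hm]
  · rwa [Measure.map_map he₁.measurable hm]
  · rw [lintegral_map hh.measurable.coe_nnreal_ennreal hm, ← ENNReal.ofReal_toReal hatop]
    refine (ENNReal.ofReal_le_ofReal h2).trans ?_
    rw [ofReal_integral_eq_lintegral_ofReal]
    · simp
    · exact (ContinuousMap.continuous _).integrable_of_hasCompactSupport
        (HasCompactSupport.of_compactSpace _)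
    · exact Eventually.of_forall fun k => (h k).2

/-- A partial plan of value at least `a` exists if all dominating pairs have an integral above `a`. -/
theorem exists_measure_map_le [StandardBorelSpace Ω] [SecondCountableTopology X]
    [SecondCountableTopology Y] {e₀ : Ω → X} {e₁ : Ω → Y} {h : Ω → ℝ≥0} (he₀ : Measurable e₀)
    (he₁ : Measurable e₁) (hh : Measurable h) (μ : Measure X) (ν : Measure Y) [IsFiniteMeasure μ]
    [IsFiniteMeasure ν] {a : ℝ≥0∞}
    (ha : ∀ p ∈ dominating e₀ e₁ (fun ω => (h ω : ℝ≥0∞)) Set.univ, a < pairIntegral μ ν p) :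
    ∃ π : Measure Ω, π.map e₀ ≤ μ ∧ π.map e₁ ≤ ν ∧ a ≤ ∫⁻ ω, h ω ∂π := by
  let := upgradeStandardBorel Ω
  -- A finer Polish topology makes all three maps continuous without changing the Borel sets.
  obtain ⟨t, hle, hc, ht⟩ := (he₀.prodMk (he₁.prodMk hh)).exists_continuous
  have hb : @BorelSpace Ω t _ := @BorelSpace.mk Ω t _ ((eq_borel_upgradeStandardBorel Ω).trans
    (@borel_eq_borel_of_le Ω t _ ht (UpgradedStandardBorel.toPolishSpace) hle).symm)
  have h0 : @Continuous Ω X t _ e₀ := continuous_fst.comp hc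
  have h1 : @Continuous Ω Y t _ e₁ := (continuous_fst.comp continuous_snd).comp hc
  have h2 : @Continuous Ω ℝ≥0 t _ h := (continuous_snd.comp continuous_snd).comp hc
  exact exists_measure_map_le_of_continuous h0 h1 h2 μ ν ha

end PartialPlan

/-! ### Completion to exact marginals -/

section Plans

variable {Ω X Y : Type*} [MeasurableSpace X] [MeasurableSpace Y]

/-- If almost all pairs are endpoints of some `ω`, a pair of functions whose sum dominates `1` has
integral at least the total mass. -/
lemma measure_univ_le_pairIntegral {e₀ : Ω → X} {e₁ : Ω → Y} {μ : Measure X} {ν : Measure Y}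
    [IsFiniteMeasure μ] (hmass : μ Set.univ = ν Set.univ) (hμ : μ Set.univ ≠ 0)
    (hcov : ∀ᶠ z in ae μ ×ˢ ae ν, ∃ ω, e₀ ω = z.1 ∧ e₁ ω = z.2)
    {p : (X → ℝ≥0∞) × (Y → ℝ≥0∞)} (hp : p ∈ dominating e₀ e₁ (fun _ => 1) Set.univ) :
    μ Set.univ ≤ pairIntegral μ ν p := by
  obtain ⟨pa, hpa, pb, hpb, hab⟩ := eventually_prod_iff.1 hcov
  have h1 : ∀ᵐ y ∂ν, μ Set.univ ≤ ∫⁻ x, p.1 x ∂μ + p.2 y * μ Set.univ := by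
    filter_upwards [hpb] with y hy
    calc μ Set.univ = ∫⁻ _, 1 ∂μ := by simp
      _ ≤ ∫⁻ x, (p.1 x + p.2 y) ∂μ := by
        refine lintegral_mono_ae ?_
        filter_upwards [hpa] with x hx
        obtain ⟨ω, h0, h1⟩ := hab hx hy
        simpa [h0, h1] using hp.2.2 ω (Set.mem_univ _)
      _ = _ := by rw [lintegral_add_right _ measurable_const, lintegral_const]
  -- Integration over both variables amounts to testing with the product measure; the common mass is
  -- then cancelled.
  have h2 : μ Set.univ * μ Set.univ ≤ μ Set.univ * pairIntegral μ ν p := by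
    calc μ Set.univ * μ Set.univ = ∫⁻ _, μ Set.univ ∂ν := by rw [lintegral_const, hmass]
      _ ≤ ∫⁻ y, (∫⁻ x, p.1 x ∂μ + p.2 y * μ Set.univ) ∂ν := lintegral_mono_ae h1
      _ = _ := by
        rw [lintegral_add_left measurable_const, lintegral_const,
          lintegral_mul_const _ hp.2.1, ← hmass, pairIntegral]
        ring
  exact (ENNReal.mul_le_mul_iff_right hμ (measure_ne_top μ _)).1 h2

variable [MeasurableSpace Ω]

lemma map_add_le_of_map_le_sub {Z : Type*} [MeasurableSpace Z] {e : Ω → Z} (he : Measurable e)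
    {μ : Measure Z} [IsFiniteMeasure μ] {π π' : Measure Ω} (h : π.map e ≤ μ)
    (h' : π'.map e ≤ μ - π.map e) : (π + π').map e ≤ μ := by
  have := isFiniteMeasure_of_le μ h
  rw [Measure.map_add _ _ he, add_comm]
  exact (add_le_add_left h' _).trans (Measure.sub_add_cancel_of_le h).le

lemma map_sum_le_of_map_sum_range_le {Z : Type*} [MeasurableSpace Z] {e : Ω → Z}
    (he : Measurable e) {μ : Measure Z} {ρ : ℕ → Measure Ω}
    (h : ∀ n, (∑ i ∈ Finset.range n, ρ i).map e ≤ μ) : (Measure.sum ρ).map e ≤ μ := by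
  refine Measure.le_iff.2 fun s hs => ?_
  rw [Measure.map_apply he hs, Measure.sum_apply _ (he hs)]
  refine ENNReal.tsum_le_of_sum_range_le fun n => ?_
  have := Measure.le_iff.1 (h n) s hs
  rw [Measure.map_apply he hs] at this
  simpa using this

variable [TopologicalSpace X] [TopologicalSpace.PseudoMetrizableSpace X]
  [SecondCountableTopology X] [BorelSpace X]
  [TopologicalSpace Y] [TopologicalSpace.PseudoMetrizableSpace Y]
  [SecondCountableTopology Y] [BorelSpace Y] [StandardBorelSpace Ω]

/-- The dual bound for `h = 1` is the total mass, but the existence theorem needs a strict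
inequality; half the mass provides it. -/
lemma exists_measure_map_le_half {e₀ : Ω → X} {e₁ : Ω → Y} (he₀ : Measurable e₀)
    (he₁ : Measurable e₁) (μ : Measure X) (ν : Measure Y) [IsFiniteMeasure μ] [IsFiniteMeasure ν]
    (hmass : μ Set.univ = ν Set.univ)
    (hcov : ∀ᶠ z in ae μ ×ˢ ae ν, ∃ ω, e₀ ω = z.1 ∧ e₁ ω = z.2) :
    ∃ π : Measure Ω, π.map e₀ ≤ μ ∧ π.map e₁ ≤ ν ∧ μ Set.univ ≤ 2 * π Set.univ := by
  by_cases hμ : μ Set.univ = 0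
  · exact ⟨0, by simp [Measure.zero_le], by simp [Measure.zero_le], by simp [hμ]⟩
  obtain ⟨π, h0, h1, h2⟩ := exists_measure_map_le (h := fun _ => 1) he₀ he₁ measurable_const μ ν
    (a := μ Set.univ / 2) fun p hp =>
      (ENNReal.half_lt_self hμ (measure_ne_top μ _)).trans_le
        (measure_univ_le_pairIntegral hmass hμ hcov (by simpa using hp))
  refine ⟨π, h0, h1, ?_⟩
  rw [ENNReal.div_le_iff' two_ne_zero ENNReal.ofNat_ne_top] at h2
  simpa using h2

/-- A plan with the prescribed marginals exists if almost all pairs are endpoints. -/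
theorem exists_measure_map_eq {e₀ : Ω → X} {e₁ : Ω → Y} (he₀ : Measurable e₀)
    (he₁ : Measurable e₁) (μ : Measure X) (ν : Measure Y) [IsFiniteMeasure μ] [IsFiniteMeasure ν]
    (hmass : μ Set.univ = ν Set.univ)
    (hcov : ∀ᶠ z in ae μ ×ˢ ae ν, ∃ ω, e₀ ω = z.1 ∧ e₁ ω = z.2) :
    ∃ π : Measure Ω, π.map e₀ = μ ∧ π.map e₁ = ν := by
  have hstep : ∀ π : {π : Measure Ω // π.map e₀ ≤ μ ∧ π.map e₁ ≤ ν}, ∃ π' : Measure Ω,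
      ((π.1 + π').map e₀ ≤ μ ∧ (π.1 + π').map e₁ ≤ ν) ∧
        μ Set.univ ≤ π.1 Set.univ + 2 * π' Set.univ := by
    rintro ⟨π, h0, h1⟩
    have := isFiniteMeasure_of_le μ h0
    have := isFiniteMeasure_of_le ν h1
    have hm0 : (μ - π.map e₀) Set.univ = μ Set.univ - π Set.univ := by
      rw [Measure.sub_apply MeasurableSet.univ h0, Measure.map_apply he₀ MeasurableSet.univ,
        Set.preimage_univ]
    have hm1 : (ν - π.map e₁) Set.univ = ν Set.univ - π Set.univ := by
      rw [Measure.sub_apply MeasurableSet.univ h1, Measure.map_apply he₁ MeasurableSet.univ,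
        Set.preimage_univ]
    obtain ⟨π', h0', h1', h2⟩ := exists_measure_map_le_half he₀ he₁ (μ - π.map e₀) (ν - π.map e₁)
      (by rw [hm0, hm1, hmass])
      -- The residual measures are smaller, so they have more null sets and the covering condition
      -- persists.
      (hcov.filter_mono (prod_mono (ae_mono Measure.sub_le)
        (ae_mono Measure.sub_le)))
    refine ⟨π', ⟨map_add_le_of_map_le_sub he₀ h0 h0', map_add_le_of_map_le_sub he₁ h1 h1'⟩, ?_⟩
    rw [hm0] at h2
    exact tsub_le_iff_left.1 h2
  choose inc hinc hhalf using hstep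
  let S : ℕ → {π : Measure Ω // π.map e₀ ≤ μ ∧ π.map e₁ ≤ ν} := fun n =>
    Nat.rec ⟨0, by simp [Measure.zero_le], by simp [Measure.zero_le]⟩
      (fun _ π => ⟨π.1 + inc π, hinc π⟩) n
  set ρ : ℕ → Measure Ω := fun n => inc (S n) with hρ
  have hS : ∀ n, (S n).1 = ∑ i ∈ Finset.range n, ρ i := by
    intro n
    induction n with
    | zero => rfl
    | succ n ih => rw [Finset.sum_range_succ, ← ih]
  have h0 : (Measure.sum ρ).map e₀ ≤ μ := map_sum_le_of_map_sum_range_le he₀ fun n =>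
    hS n ▸ (S n).2.1
  have h1 : (Measure.sum ρ).map e₁ ≤ ν := map_sum_le_of_map_sum_range_le he₁ fun n =>
    hS n ▸ (S n).2.2
  have hle : ∀ {π : Measure Ω}, π.map e₀ ≤ μ → π Set.univ ≤ μ Set.univ := fun h => by
    simpa [Measure.map_apply he₀ MeasurableSet.univ] using h Set.univ
  have hfin : ∀ {π : Measure Ω}, π.map e₀ ≤ μ → π Set.univ ≠ ∞ := fun h =>
    ((hle h).trans_lt (measure_lt_top μ _)).ne
  have hSle : ∀ n, (S n).1 Set.univ ≤ Measure.sum ρ Set.univ := fun n => by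
    rw [hS, Measure.sum_apply _ MeasurableSet.univ, Measure.coe_finsetSum, Finset.sum_apply]
    exact ENNReal.sum_le_tsum _
  -- Each increment carries at least half of the missing mass.
  have hgeom : ∀ n, μ.real Set.univ ≤ (S n).1.real Set.univ + μ.real Set.univ * (1 / 2) ^ n := by
    intro n
    induction n with
    | zero => simp
    | succ n ih =>
      have hfS := hfin (S n).2.1
      have hfS' := hfin (S (n + 1)).2.1
      have hadd : (S (n + 1)).1 Set.univ = (S n).1 Set.univ + inc (S n) Set.univ := rfl
      have hfi : inc (S n) Set.univ ≠ ∞ := by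
        rw [hadd] at hfS'
        exact (ENNReal.add_ne_top.1 hfS').2
      have h3 := ENNReal.toReal_mono (by finiteness) (hhalf (S n))
      rw [ENNReal.toReal_add hfS (by finiteness), ENNReal.toReal_mul] at h3
      simp only [measureReal_def] at ih ⊢
      rw [hadd, ENNReal.toReal_add hfS hfi, pow_succ]
      simp only [ENNReal.toReal_ofNat] at h3
      linarith
  have hmu : μ Set.univ ≤ Measure.sum ρ Set.univ := by
    rw [← ENNReal.toReal_le_toReal (measure_ne_top μ _) (hfin h0)]
    have ht : Tendsto (fun n : ℕ => (Measure.sum ρ).real Set.univ + μ.real Set.univ * (1 / 2) ^ n)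
        atTop (𝓝 ((Measure.sum ρ).real Set.univ + μ.real Set.univ * 0)) :=
      ((tendsto_pow_atTop_nhds_zero_of_lt_one (by norm_num) (by norm_num)).const_mul _).const_add _
    rw [mul_zero, add_zero] at ht
    refine ge_of_tendsto' ht fun n => (hgeom n).trans ?_
    gcongr
    exact ENNReal.toReal_mono (hfin h0) (hSle n)
  have heq : Measure.sum ρ Set.univ = μ Set.univ := le_antisymm (hle h0) hmu
  have := isFiniteMeasure_of_le μ h0
  have := isFiniteMeasure_of_le ν h1
  refine ⟨Measure.sum ρ, Measure.eq_of_le_of_measure_univ_eq h0 ?_,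
    Measure.eq_of_le_of_measure_univ_eq h1 ?_⟩
  · rw [Measure.map_apply he₀ MeasurableSet.univ, Set.preimage_univ, heq]
  · rw [Measure.map_apply he₁ MeasurableSet.univ, Set.preimage_univ, heq, hmass]

/-- A plan with the prescribed marginals and value at least `a` exists if almost all pairs are
endpoints and all dominating pairs have an integral above `a`. -/
theorem exists_measure_map_eq_of_lt {e₀ : Ω → X} {e₁ : Ω → Y} {h : Ω → ℝ≥0}
    (he₀ : Measurable e₀) (he₁ : Measurable e₁) (hh : Measurable h) (μ : Measure X)
    (ν : Measure Y) [IsFiniteMeasure μ] [IsFiniteMeasure ν] (hmass : μ Set.univ = ν Set.univ)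
    (hcov : ∀ᶠ z in ae μ ×ˢ ae ν, ∃ ω, e₀ ω = z.1 ∧ e₁ ω = z.2) {a : ℝ≥0∞}
    (ha : ∀ p ∈ dominating e₀ e₁ (fun ω => (h ω : ℝ≥0∞)) Set.univ, a < pairIntegral μ ν p) :
    ∃ π : Measure Ω, π.map e₀ = μ ∧ π.map e₁ = ν ∧ a ≤ ∫⁻ ω, h ω ∂π := by
  obtain ⟨π, h0, h1, h2⟩ := exists_measure_map_le he₀ he₁ hh μ ν ha
  have := isFiniteMeasure_of_le μ h0
  have := isFiniteMeasure_of_le ν h1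
  obtain ⟨π', h0', h1'⟩ := exists_measure_map_eq he₀ he₁ (μ - π.map e₀) (ν - π.map e₁)
    (by rw [Measure.sub_apply MeasurableSet.univ h0, Measure.sub_apply MeasurableSet.univ h1,
      Measure.map_apply he₀ MeasurableSet.univ, Measure.map_apply he₁ MeasurableSet.univ, hmass,
      Set.preimage_univ, Set.preimage_univ])
    (hcov.filter_mono (prod_mono (ae_mono Measure.sub_le)
      (ae_mono Measure.sub_le)))
  refine ⟨π + π', ?_, ?_, ?_⟩
  · rw [Measure.map_add _ _ he₀, h0', add_comm, Measure.sub_add_cancel_of_le h0]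
  · rw [Measure.map_add _ _ he₁, h1', add_comm, Measure.sub_add_cancel_of_le h1]
  · rw [lintegral_add_measure]
    exact h2.trans le_self_add

end Plans

/-! ### Extended real integrals -/

section ExtIntegral

variable {α : Type*} [MeasurableSpace α] {μ : Measure α}

lemma lintegral_ofReal_ne_top {v : α → ℝ} (hv : Integrable v μ) :
    ∫⁻ a, ENNReal.ofReal (v a) ∂μ ≠ ∞ :=
  (hv.lintegral_lt_top).ne

lemma coe_integral_eq_sub {v : α → ℝ} (hv : Integrable v μ) :
    ((∫ a, v a ∂μ : ℝ) : EReal) = ((∫⁻ a, ENNReal.ofReal (v a) ∂μ : ℝ≥0∞) : EReal) -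
      ((∫⁻ a, ENNReal.ofReal (-v a) ∂μ : ℝ≥0∞) : EReal) := by
  rw [integral_eq_lintegral_pos_part_sub_lintegral_neg_part hv, EReal.coe_sub,
    EReal.coe_ennreal_toReal (lintegral_ofReal_ne_top hv),
    EReal.coe_ennreal_toReal (x := ∫⁻ a, ENNReal.ofReal (-v a) ∂μ) (lintegral_ofReal_ne_top hv.neg)]

lemma extIntegral_coe_eq_sub {v : α → ℝ} (hv : ∫⁻ a, ENNReal.ofReal (v a) ∂μ ≠ ∞) :
    extIntegral μ (fun a => (v a : EReal)) = ((∫⁻ a, ENNReal.ofReal (v a) ∂μ : ℝ≥0∞) : EReal) -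
      ((∫⁻ a, ENNReal.ofReal (-v a) ∂μ : ℝ≥0∞) : EReal) :=
  if_neg hv

lemma le_extIntegral {v : α → ℝ} {h : α → EReal} (hv : Integrable v μ)
    (hvh : ∀ᵐ a ∂μ, (v a : EReal) ≤ h a) :
    ((∫ a, v a ∂μ : ℝ) : EReal) ≤ extIntegral μ h := by
  unfold extIntegral
  split_ifs with htop
  · exact le_top
  rw [coe_integral_eq_sub hv]
  refine EReal.sub_le_sub ?_ ?_
  · refine EReal.coe_ennreal_le_coe_ennreal_iff.2 (lintegral_mono_ae ?_)
    filter_upwards [hvh] with a ha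
    rw [← EReal.real_coe_toENNReal]
    exact EReal.toENNReal_le_toENNReal ha
  · refine EReal.coe_ennreal_le_coe_ennreal_iff.2 (lintegral_mono_ae ?_)
    filter_upwards [hvh] with a ha
    rw [← EReal.real_coe_toENNReal, EReal.coe_neg]
    exact EReal.toENNReal_le_toENNReal (EReal.neg_le_neg_iff.2 ha)

lemma extIntegral_coe {v : α → ℝ} (hv : Integrable v μ) :
    extIntegral μ (fun a => (v a : EReal)) = ((∫ a, v a ∂μ : ℝ) : EReal) := by
  rw [extIntegral_coe_eq_sub (lintegral_ofReal_ne_top hv), coe_integral_eq_sub hv]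

/-- If `∫ h` is infinite, the positive part of `u - h` still has a finite integral, and the value on
the left is `-∞`. -/
lemma extIntegral_sub_le {u : α → ℝ} {h : α → ℝ≥0} (hu : Integrable u μ) (hh : Measurable h)
    {A : ℝ} (hA : ENNReal.ofReal A ≤ ∫⁻ a, h a ∂μ) :
    extIntegral μ (fun a => ((u a - h a : ℝ) : EReal)) ≤ ((∫ a, u a ∂μ - A : ℝ) : EReal) := by
  by_cases hfin : ∫⁻ a, h a ∂μ = ∞
  · have hP : ∫⁻ a, ENNReal.ofReal (u a - h a) ∂μ ≠ ∞ :=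
      ne_top_of_le_ne_top (lintegral_ofReal_ne_top hu) (lintegral_mono fun a =>
        ENNReal.ofReal_le_ofReal (by linarith [(h a).coe_nonneg]))
    have hN : ∫⁻ a, ENNReal.ofReal (-(u a - h a)) ∂μ = ∞ := by
      by_contra hN
      refine absurd hfin (ne_top_of_le_ne_top
        (ENNReal.add_ne_top.2 ⟨hN, lintegral_ofReal_ne_top hu⟩) ?_)
      rw [← lintegral_add_right' _ hu.aemeasurable.ennreal_ofReal]
      refine lintegral_mono fun a => ?_
      rw [← ENNReal.ofReal_coe_nnreal]
      exact (ENNReal.ofReal_le_ofReal (by linarith)).trans ENNReal.ofReal_add_le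
    rw [extIntegral_coe_eq_sub hP, hN]
    lift ∫⁻ a, ENNReal.ofReal (u a - h a) ∂μ to ℝ≥0 using hP with P
    simp
  · have hhi : Integrable (fun a => (h a : ℝ)) μ := by
      refine ⟨hh.coe_nnreal_real.aestronglyMeasurable, ?_⟩
      rw [hasFiniteIntegral_iff_ofReal (Eventually.of_forall fun a => (h a).coe_nonneg)]
      simpa using lt_top_iff_ne_top.2 hfin
    have h0 := extIntegral_coe (hu.sub hhi)
    simp only [Pi.sub_apply] at h0
    rw [h0, integral_sub hu hhi, EReal.coe_le_coe_iff]
    have h1 : A ≤ ∫ a, (h a : ℝ) ∂μ := by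
      rw [← ENNReal.ofReal_le_ofReal_iff (integral_nonneg fun a => (h a).coe_nonneg),
        ofReal_integral_eq_lintegral_ofReal hhi (Eventually.of_forall fun a => (h a).coe_nonneg)]
      simpa using hA
    linarith

lemma extIntegral_map {β : Type*} [MeasurableSpace β] {e : α → β} (he : Measurable e)
    {h : β → EReal} (hh : Measurable h) :
    extIntegral (μ.map e) h = extIntegral μ (h ∘ e) := by
  unfold extIntegral
  rw [lintegral_map hh.ereal_toENNReal he, lintegral_map (f := fun b => (-h b).toENNReal) (continuous_neg.measurable.comp hh).ereal_toENNReal he]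
  rfl

end ExtIntegral

/-! ### Duality for two measurable endpoint maps -/

section AbstractDuality

variable {Ω X Y : Type*} [MeasurableSpace Ω] [StandardBorelSpace Ω]
  [TopologicalSpace X] [TopologicalSpace.PseudoMetrizableSpace X] [SecondCountableTopology X]
  [MeasurableSpace X] [BorelSpace X]
  [TopologicalSpace Y] [TopologicalSpace.PseudoMetrizableSpace Y] [SecondCountableTopology Y]
  [MeasurableSpace Y] [BorelSpace Y]

/-- If the dual value is smaller than `b`, some plan has cost at most `b`. -/
theorem exists_plan_extIntegral_le {e₀ : Ω → X} {e₁ : Ω → Y} (he₀ : Measurable e₀)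
    (he₁ : Measurable e₁) {c : Ω → EReal} (hc : Measurable c) (hbot : ∀ ω, c ω ≠ ⊥)
    {μ : Measure X} {ν : Measure Y} [IsFiniteMeasure μ] [IsFiniteMeasure ν]
    (hmass : μ Set.univ = ν Set.univ) {f : X → ℝ} {g : Y → ℝ} (hf : Integrable f μ)
    (hg : Integrable g ν) (hfm : Measurable f) (hgm : Measurable g)
    (hcov : ∀ᶠ z in ae μ ×ˢ ae ν, ∃ ω, e₀ ω = z.1 ∧ e₁ ω = z.2 ∧
      c ω ≤ ((f z.1 + g z.2 : ℝ) : EReal)) {b : ℝ}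
    (hb : ∀ (φ : X → ℝ) (ψ : Y → ℝ), Integrable φ μ → Integrable ψ ν →
      (∀ᶠ z in ae μ ×ˢ ae ν, ∀ ω, e₀ ω = z.1 → e₁ ω = z.2 →
        ((φ z.1 + ψ z.2 : ℝ) : EReal) ≤ c ω) → ∫ x, φ x ∂μ + ∫ y, ψ y ∂ν < b) :
    ∃ π : Measure Ω, π.map e₀ = μ ∧ π.map e₁ = ν ∧ extIntegral π c ≤ b := by
  set S : Set Ω := {ω | c ω ≤ ((f (e₀ ω) + g (e₁ ω) : ℝ) : EReal)} with hSdef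
  have hSm : MeasurableSet S := measurableSet_le hc
    ((hfm.comp he₀).add (hgm.comp he₁)).coe_real_ereal
  have := hSm.standardBorel
  have hcreal : ∀ ω ∈ S, ((c ω).toReal : EReal) = c ω := fun ω hω =>
    EReal.coe_toReal (hω.trans_lt (EReal.coe_lt_top _)).ne (hbot ω)
  set u : S → ℝ := fun ω => f (e₀ ω) + g (e₁ ω) with hu
  set h : S → ℝ≥0 := fun ω => (u ω - (c ω).toReal).toNNReal with hhdef
  have hum : Measurable u := by fun_prop
  have hhm : Measurable h :=
    (hum.sub (hc.comp measurable_subtype_coe).ereal_toReal).real_toNNReal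
  have hh : ∀ ω : S, (h ω : ℝ) = u ω - (c ω).toReal := fun ω => by
    refine Real.coe_toNNReal _ (sub_nonneg.2 ?_)
    rw [← EReal.coe_le_coe_iff, hcreal ω ω.2]
    exact ω.2
  have hch : ∀ ω : S, c ω = ((u ω - h ω : ℝ) : EReal) := fun ω => by
    rw [hh, sub_sub_cancel, hcreal ω ω.2]
  have he₀' : Measurable fun ω : S => e₀ ω := he₀.comp measurable_subtype_coe
  have he₁' : Measurable fun ω : S => e₁ ω := he₁.comp measurable_subtype_coe
  have hcov' : ∀ᶠ z in ae μ ×ˢ ae ν, ∃ ω : S, e₀ ω = z.1 ∧ e₁ ω = z.2 := by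
    filter_upwards [hcov] with z ⟨ω, h0, h1, h2⟩
    exact ⟨⟨ω, by simpa [hSdef, h0, h1] using h2⟩, h0, h1⟩
  set A : ℝ := ∫ x, f x ∂μ + ∫ y, g y ∂ν - b with hA
  obtain ⟨π, hπ0, hπ1, hπA⟩ : ∃ π : Measure S, π.map (fun ω : S => e₀ ω) = μ ∧
      π.map (fun ω : S => e₁ ω) = ν ∧ ENNReal.ofReal A ≤ ∫⁻ ω, h ω ∂π := by
    -- If `A ≤ 0`, any plan carried by `S` costs at most `∫ f + ∫ g ≤ b`.
    rcases le_or_gt A 0 with hA0 | hA0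
    · obtain ⟨π, h0, h1⟩ := exists_measure_map_eq he₀' he₁' μ ν hmass hcov'
      exact ⟨π, h0, h1, by simp [ENNReal.ofReal_of_nonpos hA0]⟩
    refine exists_measure_map_eq_of_lt he₀' he₁' hhm μ ν hmass hcov' fun p hp => ?_
    by_contra! hcon
    have hfin := ENNReal.add_ne_top.1 (ne_top_of_le_ne_top ENNReal.ofReal_ne_top hcon)
    have hφ := integrable_toReal_of_lintegral_ne_top hp.1.aemeasurable hfin.1
    have hψ := integrable_toReal_of_lintegral_ne_top hp.2.1.aemeasurable hfin.2
    have hlt := hb (fun x => f x - (p.1 x).toReal) (fun y => g y - (p.2 y).toReal)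
      (hf.sub hφ) (hg.sub hψ) (by
        filter_upwards [(ae_lt_top hp.1 hfin.1).prod_inl (ae ν),
          (ae_lt_top hp.2.1 hfin.2).prod_inr (ae μ)] with z hz0 hz1 ω h0 h1
        by_cases hω : ω ∈ S
        · rw [hch ⟨ω, hω⟩, EReal.coe_le_coe_iff]
          have h2 := hp.2.2 ⟨ω, hω⟩ (Set.mem_univ _)
          simp only [h0, h1] at h2
          have h3 := ENNReal.toReal_mono (ENNReal.add_ne_top.2 ⟨hz0.ne, hz1.ne⟩) h2
          rw [ENNReal.toReal_add hz0.ne hz1.ne, ENNReal.coe_toReal] at h3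
          simp only [hu, h0, h1]
          linarith
        -- Outside `S` the constraint is automatic, because the new pair lies below `(f, g)`.
        · have h2 : ((f (e₀ ω) + g (e₁ ω) : ℝ) : EReal) < c ω := not_le.1 hω
          rw [h0, h1] at h2
          refine le_trans (EReal.coe_le_coe_iff.2 ?_) h2.le
          linarith [(p.1 z.1).toReal_nonneg, (p.2 z.2).toReal_nonneg])
    rw [integral_sub hf hφ, integral_sub hg hψ, integral_toReal hp.1.aemeasurable
      (ae_lt_top hp.1 hfin.1), integral_toReal hp.2.1.aemeasurable (ae_lt_top hp.2.1 hfin.2)] at hlt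
    have h4 := ENNReal.toReal_le_of_le_ofReal hA0.le hcon
    rw [pairIntegral, ENNReal.toReal_add hfin.1 hfin.2] at h4
    linarith
  have hui : Integrable u π := by
    refine Integrable.add ?_ ?_
    · rw [← hπ0] at hf
      exact hf.comp_measurable he₀'
    · rw [← hπ1] at hg
      exact hg.comp_measurable he₁'
  refine ⟨π.map (↑), ?_, ?_, ?_⟩
  · rw [Measure.map_map he₀ measurable_subtype_coe]
    exact hπ0
  · rw [Measure.map_map he₁ measurable_subtype_coe]
    exact hπ1
  · rw [extIntegral_map measurable_subtype_coe hc]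
    have h1 := extIntegral_sub_le hui hhm hπA
    have h2 : ∫ ω, u ω ∂π = ∫ x, f x ∂μ + ∫ y, g y ∂ν := by
      rw [← hπ0] at hf
      rw [← hπ1] at hg
      refine (integral_add (hf.comp_measurable he₀') (hg.comp_measurable he₁')).trans ?_
      simp only [Function.comp_apply]
      congr 1
      · rw [← hπ0, integral_map he₀'.aemeasurable hf.aestronglyMeasurable]
      · rw [← hπ1, integral_map he₁'.aemeasurable hg.aestronglyMeasurable]
    have h3 : (c ∘ (↑) : S → EReal) = fun ω => ((u ω - h ω : ℝ) : EReal) := funext hch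
    rw [h3]
    refine h1.trans_eq ?_
    rw [h2, hA]
    congr 1
    ring

end AbstractDuality

/-! ### Path space: weak duality, no gap, and pointwise dual pairs -/

lemma tendsto_integral_min_natCast {α : Type*} [MeasurableSpace α] {μ : Measure α} {φ : α → ℝ}
    (hφ : Integrable φ μ) :
    Tendsto (fun n : ℕ => ∫ x, min (φ x) n ∂μ) atTop (𝓝 (∫ x, φ x ∂μ)) := by
  refine tendsto_integral_of_dominated_convergence (fun x => |φ x|)
    (fun n => (hφ.aestronglyMeasurable.inf aestronglyMeasurable_const)) hφ.abs
    (fun n => Eventually.of_forall fun x => ?_) (Eventually.of_forall fun x => ?_)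
  · rw [Real.norm_eq_abs]
    refine abs_le.2 ⟨le_min (neg_abs_le _) ?_, (min_le_left _ _).trans (le_abs_self _)⟩
    exact (neg_nonpos.2 (abs_nonneg _)).trans n.cast_nonneg
  · refine tendsto_const_nhds.congr' ?_
    filter_upwards [eventually_ge_atTop ⌈φ x⌉₊] with n hn
    exact (min_eq_left ((Nat.le_ceil _).trans (Nat.cast_le.2 hn))).symm

section PathSpace

variable {n : ℕ} {X : Set (EuclideanSpace ℝ (Fin n))} {c : PathSpace X → EReal}
  {μ₀ μ₁ : ProbabilityMeasure X}

lemma measurable_eval_pathSpace (t : I) : Measurable fun γ : PathSpace X => γ t :=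
  (continuous_eval_const t).measurable

lemma endpointCost_le (γ : PathSpace X) : endpointCost c (γ 0) (γ 1) ≤ c γ :=
  iInf₂_le γ ⟨rfl, rfl⟩

/-- Weak duality. -/
theorem dualValue_dualPairsAE_le_pathValue :
    dualValue (dualPairsAE c μ₀ μ₁) μ₀ μ₁ ≤ pathValue c μ₀ μ₁ := by
  refine iSup₂_le fun p hp => le_iInf₂ fun π hπ => ?_
  obtain ⟨h0, h1, h2⟩ := hp
  obtain ⟨hπ0, hπ1⟩ := hπ
  have ht0 : Tendsto (fun γ : PathSpace X => γ 0) (ae (π : Measure (PathSpace X)))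
      (ae (μ₀ : Measure X)) := hπ0 ▸ Measure.tendsto_ae_map (measurable_eval_pathSpace 0).aemeasurable
  have ht1 : Tendsto (fun γ : PathSpace X => γ 1) (ae (π : Measure (PathSpace X)))
      (ae (μ₁ : Measure X)) := hπ1 ▸ Measure.tendsto_ae_map (measurable_eval_pathSpace 1).aemeasurable
  have hi0 := (hπ0 ▸ h0 : Integrable p.1 ((π : Measure (PathSpace X)).map fun γ => γ 0))
  have hi1 := (hπ1 ▸ h1 : Integrable p.2 ((π : Measure (PathSpace X)).map fun γ => γ 1))
  have hc0 := hi0.comp_measurable (measurable_eval_pathSpace 0)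
  have hc1 := hi1.comp_measurable (measurable_eval_pathSpace 1)
  have hle := le_extIntegral (h := c) (hc0.add hc1) (by
    filter_upwards [(ht0.prodMk ht1).eventually h2] with γ hγ
    exact hγ.trans (endpointCost_le γ))
  refine le_trans (le_of_eq ?_) hle
  rw [integral_add' hc0 hc1, ← hπ0, ← hπ1,
    integral_map (measurable_eval_pathSpace 0).aemeasurable hi0.aestronglyMeasurable,
    integral_map (measurable_eval_pathSpace 1).aemeasurable hi1.aestronglyMeasurable]
  rfl

/-- Absence of a duality gap. -/
theorem pathValue_le_dualValue_dualPairsAE (hX : IsCompact X) (hc : LowerSemicontinuous c)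
    (hc_ne : ∀ γ, c γ ≠ ⊥) {f g : X → ℝ} (hf : Integrable f (μ₀ : Measure X))
    (hg : Integrable g (μ₁ : Measure X))
    (hfg : ∀ᶠ z in ae (μ₀ : Measure X) ×ˢ ae (μ₁ : Measure X),
      endpointCost c z.1 z.2 ≤ ((f z.1 + g z.2 : ℝ) : EReal)) :
    pathValue c μ₀ μ₁ ≤ dualValue (dualPairsAE c μ₀ μ₁) μ₀ μ₁ := by
  have : CompactSpace X := isCompact_iff_compactSpace.1 hX
  refine EReal.le_of_forall_lt_iff_le.1 fun b hb => ?_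
  -- The added `1` turns the bound on the endpoint cost into a strict one, so some path satisfies it
  -- even if the infimum is not attained.
  set f' : X → ℝ := fun x => hf.1.mk f x + 1
  set g' : X → ℝ := hg.1.mk g
  have hfm : Measurable f' := (hf.1.stronglyMeasurable_mk.measurable).add_const 1
  have hgm : Measurable g' := hg.1.stronglyMeasurable_mk.measurable
  have hf' : Integrable f' (μ₀ : Measure X) := (hf.congr hf.1.ae_eq_mk).add (integrable_const 1)
  have hg' : Integrable g' (μ₁ : Measure X) := hg.congr hg.1.ae_eq_mk
  obtain ⟨π, h0, h1, h2⟩ := exists_plan_extIntegral_le (Ω := PathSpace X)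
    (measurable_eval_pathSpace 0) (measurable_eval_pathSpace 1) hc.measurable hc_ne
    (μ := (μ₀ : Measure X)) (ν := (μ₁ : Measure X)) (by simp) hf' hg' hfm hgm (by
      filter_upwards [hfg, hf.1.ae_eq_mk.prod_inl (ae (μ₁ : Measure X)),
        hg.1.ae_eq_mk.prod_inr (ae (μ₀ : Measure X))] with z hz hz0 hz1
      have hlt : endpointCost c z.1 z.2 < ((f' z.1 + g' z.2 : ℝ) : EReal) := by
        refine hz.trans_lt (EReal.coe_lt_coe_iff.2 ?_)
        simp only [f', g']
        linarith
      obtain ⟨γ, hγ⟩ := iInf_lt_iff.1 hlt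
      obtain ⟨⟨hγ0, hγ1⟩, hγ2⟩ := iInf_lt_iff.1 hγ
      exact ⟨γ, hγ0, hγ1, hγ2.le⟩) (b := b) fun φ ψ hφ hψ hφψ => by
    rw [← EReal.coe_lt_coe_iff]
    refine lt_of_le_of_lt ?_ hb
    refine le_iSup₂_of_le (f := fun (p : (X → ℝ) × (X → ℝ)) _ =>
      ((∫ x, p.1 x ∂(μ₀ : Measure X) + ∫ y, p.2 y ∂(μ₁ : Measure X) : ℝ) : EReal))
      (φ, ψ) ⟨hφ, hψ, ?_⟩ le_rfl
    filter_upwards [hφψ] with z hz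
    exact le_iInf₂ fun γ hγ => hz γ hγ.1 hγ.2
  have hπ : IsProbabilityMeasure π := by
    refine ⟨?_⟩
    have := congrArg (fun m : Measure X => m Set.univ) h0
    simpa [Measure.map_apply (measurable_eval_pathSpace 0) MeasurableSet.univ] using this
  exact (iInf₂_le (⟨π, hπ⟩ : ProbabilityMeasure (PathSpace X)) ⟨h0, h1⟩).trans h2

/-- A dual pair for `L¹` classes can be truncated and modified on null sets so as to satisfy its
constraint everywhere, if the cost is bounded from below. -/
theorem dualValue_dualPairsAE_le_dualValue_dualPairs {K : ℝ} (hK : ∀ γ, (K : EReal) ≤ c γ) :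
    dualValue (dualPairsAE c μ₀ μ₁) μ₀ μ₁ ≤ dualValue (dualPairs c μ₀ μ₁) μ₀ μ₁ := by
  classical
  have hKe : ∀ x y : X, (K : EReal) ≤ endpointCost c x y := fun x y => le_iInf₂ fun γ _ => hK γ
  refine iSup₂_le fun p hp => ?_
  obtain ⟨h0, h1, h2⟩ := hp
  obtain ⟨pa, hpa, pb, hpb, hab⟩ := eventually_prod_iff.1 h2
  have ht := (continuous_coe_real_ereal.tendsto _).comp
    ((tendsto_integral_min_natCast h0).add (tendsto_integral_min_natCast h1))
  refine le_of_tendsto ht ?_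
  filter_upwards [eventually_ge_atTop ⌈K⌉₊] with m hm
  have hKm : K ≤ m := (Nat.le_ceil _).trans (Nat.cast_le.2 hm)
  have hm0 : (0 : ℝ) ≤ m := m.cast_nonneg
  -- Both truncated functions are at most `m`, so a single value `K - m` brings the sum down to `K`,
  -- the lower bound of the cost. Two such values suffice as well because `K ≤ m` and `0 ≤ m`.
  have heq0 : (fun x => if pa x then min (p.1 x) m else K - m)
      =ᵐ[(μ₀ : Measure X)] fun x => min (p.1 x) m := by
    filter_upwards [hpa] with x hx using if_pos hx
  have heq1 : (fun y => if pb y then min (p.2 y) m else K - m)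
      =ᵐ[(μ₁ : Measure X)] fun y => min (p.2 y) m := by
    filter_upwards [hpb] with y hy using if_pos hy
  refine le_iSup₂_of_le (f := fun (p : (X → ℝ) × (X → ℝ)) _ =>
      ((∫ x, p.1 x ∂(μ₀ : Measure X) + ∫ y, p.2 y ∂(μ₁ : Measure X) : ℝ) : EReal))
    (fun x => if pa x then min (p.1 x) m else K - m,
      fun y => if pb y then min (p.2 y) m else K - m) ⟨?_, ?_, fun x y => ?_⟩ (le_of_eq ?_)
  · exact (h0.inf (integrable_const _)).congr heq0.symm
  · exact (h1.inf (integrable_const _)).congr heq1.symm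
  · have hx := min_le_right (p.1 x) m
    have hy := min_le_right (p.2 y) m
    by_cases hpx : pa x
    · by_cases hpy : pb y
      · refine le_trans (EReal.coe_le_coe_iff.2 ?_) (hab hpx hpy)
        simpa [hpx, hpy] using add_le_add (min_le_left (p.1 x) m) (min_le_left (p.2 y) m)
      · refine le_trans (EReal.coe_le_coe_iff.2 ?_) (hKe x y)
        simp only [hpx, hpy, if_true, if_false]
        linarith
    · refine le_trans (EReal.coe_le_coe_iff.2 ?_) (hKe x y)
      by_cases hpy : pb y
      · simp only [hpx, hpy, if_true, if_false]
        linarith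
      · simp only [hpx, hpy, if_false]
        linarith
  · simp only [Function.comp_apply]
    rw [integral_congr_ae heq0, integral_congr_ae heq1]

lemma dualValue_mono {P Q : Set ((X → ℝ) × (X → ℝ))} (h : P ⊆ Q) :
    dualValue P μ₀ μ₁ ≤ dualValue Q μ₀ μ₁ :=
  biSup_mono h

lemma dualPairs_subset_dualPairsAE : dualPairs c μ₀ μ₁ ⊆ dualPairsAE c μ₀ μ₁ :=
  fun _ hp => ⟨hp.1, hp.2.1, Eventually.of_forall fun z => hp.2.2 z.1 z.2⟩

end PathSpace

theorem mainTheorem5 {n : ℕ} (U X : Set (EuclideanSpace ℝ (Fin n)))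
    (hUo : IsOpen U) (hUb : Bornology.IsBounded U) (hUc : IsConnected U) (hX : X = closure U)
    (c : PathSpace X → EReal) (hc : LowerSemicontinuous c) (hc_ne : ∀ γ, c γ ≠ ⊥)
    (μ₀ μ₁ : ProbabilityMeasure X)
    (f g : X → ℝ) (hf : Integrable f (μ₀ : Measure X)) (hg : Integrable g (μ₁ : Measure X))
    (hfg : ∀ᶠ z in ae (μ₀ : Measure X) ×ˢ ae (μ₁ : Measure X),
      endpointCost c z.1 z.2 ≤ ((f z.1 + g z.2 : ℝ) : EReal)) :
    pathValue c μ₀ μ₁ = dualValue (dualPairsAE c μ₀ μ₁) μ₀ μ₁ ∧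
      ((∃ K : ℝ, ∀ γ, (K : EReal) ≤ c γ) →
        pathValue c μ₀ μ₁ = dualValue (dualPairs c μ₀ μ₁) μ₀ μ₁) := by
  have hXc : IsCompact X := hX ▸ hUb.isCompact_closure
  have hAE : pathValue c μ₀ μ₁ = dualValue (dualPairsAE c μ₀ μ₁) μ₀ μ₁ :=
    le_antisymm (pathValue_le_dualValue_dualPairsAE hXc hc hc_ne hf hg hfg)
      dualValue_dualPairsAE_le_pathValue
  refine ⟨hAE, fun ⟨K, hK⟩ => hAE.trans (le_antisymm ?_ ?_)⟩
  · exact dualValue_dualPairsAE_le_dualValue_dualPairs hK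
  · exact dualValue_mono dualPairs_subset_dualPairsAE
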